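/- **Setting.** There are $n$ users; user $u$ holds a private value $X_u\in[0,1]$. A subset $U^H$ of $n_H\ge 1$ users is honest, the others are malicious and collude; put $\rho=n_H/n$. On a graph $G=(U,E)$, GOPA with variances $\sigma_\eta^2,\sigma_\Delta^2$ works as follows: every edge $\{u,v\}\in E$ with $u<v$ draws $x\sim\mathcal N(0,\sigma_\Delta^2)$ and sets $\Delta_{u,v}=x$, $\Delta_{v,u}=-x$; every user $u$ draws $\eta_u\sim\mathcal N(0,\sigma_\eta^2)$ and publishes $\hat X_u=X_u+\sum_{v\in N(u)}\Delta_{u,v}+\eta_u$; all draws are independent. The draws in which malicious users take part (their $\eta_u$, and the $\Delta_{u,v}$ with $u$ or $v$ malicious) may even have an arbitrary joint law, possibly depending on the graph, as long as they are independent of the draws among honest users. The adversary sees $G$, all $\hat X_u$, the $X_u$ and $\eta_u$ of the malicious users, and all $\Delta_{u,v}$ with $u$ or $v$ malicious. GOPA is $(\varepsilon,\delta)$-DP if, for all inputs $X,X'\in[0,1]^n$ that differ only in the value of one honest user and every measurable set $\mathcal O$, the view $V(X)$ of the adversary satisfies $\Pr(V(X)\in\mathcal O)\le e^{\varepsilon}\Pr(V(X')\in\mathcal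 O)+\delta$. $G^H$ denotes the subgraph of $G$ induced by $U^H$. In a random $k$-out graph ($k<n$), every honest user selects $k$ other users uniformly at random and independently, the selections of malicious users are arbitrary (deterministic or random, independent of the honest ones, for instance also uniform), and $\{u,v\}\in E$ iff $u$ selected $v$ or $v$ selected $u$; the probabilities in the definition of DP are then also over the graph. **Statement.** Let $\varepsilon,\delta'\in(0,1)$, let $\sigma_\eta^2=\dfrac{c^2}{n_H\varepsilon^2}$ with $c^2>2\log(1.25/\delta')$, and let $\kappa>0$. 1. If $G^H$ is complete (in particular if $G$ is) and $\sigma_\Delta^2=\kappa\sigma_\eta^2$, then GOPA is $(\varepsilon,\delta)$-DP for every $\delta\ge 1.25\,(\delta'/1.25)^{\kappa/(\kappa+1)}$. 2. Let $G$ be a random $k$-out graph, $\sigma_\Delta^2=\kappa\sigma_\eta^2\, n_H\Big(\dfrac{1}{\lfloor (k-1)\rho/3\rfloor-1}+\dfrac{12+6\log n_H}{n_H}\Big)$ and $\delta\ge 3.75\,(\delta'/1.25)^{\kappa/(\kappa+1)}$. If $\rho n\ge 81$, $\rho k\ge 4\log(2\rho n/\delta)$, $\rho k\ge 6\log(\rho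 n/3)$ and $\rho k\ge\frac32+\frac94\log(6e/\delta)$, then the whole process (generation of $G$ followed by GOPA) is $(\varepsilon,\delta)$-DP. 3. If $G^H$ is connected and $\sigma_\Delta^2=\kappa\sigma_\eta^2\, n_H^2/3$, then GOPA is $(\varepsilon,\delta)$-DP for every $\delta\ge 1.25\,(\delta'/1.25)^{\kappa/(\kappa+1)}$. -/

import Mathlib

open MeasureTheory ProbabilityTheory
open scoped NNReal ENNReal

namespace Gopa

noncomputable section

/-! Users are the elements of `Fin n`; the set of honest users is a finset `H`. -/

/-- The random draws made in one run: `ω.1 u` is the independent noise `η_u` of user `u`, and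
`ω.2 s(u, v)` is the number `x` drawn jointly by `u` and `v` (draws that belong to no edge are
never used). -/
abbrev Noise (n : ℕ) : Type := (Fin n → ℝ) × (Sym2 (Fin n) → ℝ)

/-- The law prescribed by the protocol: all draws are independent, `η_u ∼ 𝒩(0, σ_η²)` and
`x ∼ 𝒩(0, σ_Δ²)`. -/
def protocolNoise (n : ℕ) (varEta varDelta : ℝ≥0) : Measure (Noise n) :=
  (Measure.pi fun _ : Fin n => gaussianReal 0 varEta).prod
    (Measure.pi fun _ : Sym2 (Fin n) => gaussianReal 0 varDelta)

open Classical in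
/-- The draws of a run in which honest users and pairs of honest users use the draws in `ω`, while
malicious users and pairs with at least one malicious member use the draws in `α`. -/
def merge {n : ℕ} (H : Finset (Fin n)) (ω α : Noise n) : Noise n :=
  (fun u => if u ∈ H then ω.1 u else α.1 u,
   fun e => if ∀ u ∈ e, u ∈ H then ω.2 e else α.2 e)

open Classical in
/-- `Δ_{u,v}`: for an edge `{u, v}` with `u < v`, `Δ_{u,v} = x` and `Δ_{v,u} = -x`; it is `0` when
`u` and `v` are not neighbors. -/
def pairNoise {n : ℕ} (G : SimpleGraph (Fin n)) (ω : Noise n) (u v : Fin n) : ℝ :=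
  if G.Adj u v then (if u < v then ω.2 s(u, v) else - ω.2 s(u, v)) else 0

open Classical in
/-- The published value `X_u + ∑_{v ∈ N(u)} Δ_{u,v} + η_u` of user `u`. -/
def noisyValue {n : ℕ} (G : SimpleGraph (Fin n)) (X : Fin n → ℝ) (ω : Noise n) (u : Fin n) : ℝ :=
  X u + ∑ v ∈ G.neighborFinset u, pairNoise G ω u v + ω.1 u

/-- What the adversary sees: the network graph, the published values of all users, the private
values and the independent noise of the malicious users, and all `Δ_{u,v}` for which `u` or `v` is
malicious. -/
abbrev View (n : ℕ) (H : Finset (Fin n)) : Type :=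
  SimpleGraph (Fin n) × (Fin n → ℝ) × ({u : Fin n // u ∉ H} → ℝ) × ({u : Fin n // u ∉ H} → ℝ) ×
    ({p : Fin n × Fin n // p.1 ∉ H ∨ p.2 ∉ H} → ℝ)

/-- The adversary's view of a run on the graph `G` with private values `X` and draws `ω`. -/
def view {n : ℕ} (G : SimpleGraph (Fin n)) (H : Finset (Fin n)) (X : Fin n → ℝ) (ω : Noise n) :
    View n H :=
  (G, fun u => noisyValue G X ω u, fun u => X u, fun u => ω.1 u,
    fun p => pairNoise G ω p.1.1 p.1.2)

/-- The view is a measurable function of the draws, so the image measure below is not a junk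
value. -/
theorem measurable_view {n : ℕ} (G : SimpleGraph (Fin n)) (H : Finset (Fin n)) (X : Fin n → ℝ) :
    Measurable fun p : Noise n × Noise n => view G H X (merge H p.1 p.2) := by
  have h1 : ∀ u, Measurable fun p : Noise n × Noise n => (merge H p.1 p.2).1 u := by
    intro u
    by_cases h : u ∈ H <;> simp only [merge, h, if_true, if_false] <;> fun_prop
  have h2 : ∀ e, Measurable fun p : Noise n × Noise n => (merge H p.1 p.2).2 e := by
    intro e
    by_cases h : ∀ u ∈ e, u ∈ H
    · simp only [merge, if_pos h]; fun_prop
    · simp only [merge, if_neg h]; fun_prop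
  have h3 : ∀ u v, Measurable fun p : Noise n × Noise n => pairNoise G (merge H p.1 p.2) u v := by
    intro u v
    have := h2 s(u, v)
    by_cases h : G.Adj u v <;> by_cases h' : u < v <;>
      simp only [pairNoise, h, h', if_true, if_false] <;> fun_prop
  unfold view noisyValue
  fun_prop

/-- The law of the adversary's view when GOPA is run on the graph `G` with private values `X`. The
draws among honest users follow the protocol; those in which malicious users take part have the
joint law `ν`, independently. The case where malicious users also follow the protocol is
`ν = protocolNoise n varEta varDelta`. -/
def gopa {n : ℕ} (G : SimpleGraph (Fin n)) (H : Finset (Fin n)) (varEta varDelta : ℝ≥0)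
    (ν : Measure (Noise n)) (X : Fin n → ℝ) : Measure (View n H) :=
  ((protocolNoise n varEta varDelta).prod ν).map fun p => view G H X (merge H p.1 p.2)

/-- All ways in which every user can select `k` other users. -/
def selections (n k : ℕ) : Finset (Fin n → Finset (Fin n)) :=
  Fintype.piFinset fun u => (Finset.univ.erase u).powersetCard k

theorem selections_nonempty {n k : ℕ} (hk : k < n) : (selections n k).Nonempty := by
  refine Fintype.piFinset_nonempty.2 fun u => Finset.powersetCard_nonempty.2 ?_
  rw [Finset.card_erase_of_mem (Finset.mem_univ u), Finset.card_univ, Fintype.card_fin]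
  omega

/-- The graph in which `{u, v}` is an edge iff `u` selected `v` or `v` selected `u`. -/
def selectionGraph {n : ℕ} (S : Fin n → Finset (Fin n)) : SimpleGraph (Fin n) :=
  SimpleGraph.fromRel fun u v => v ∈ S u

open Classical in
/-- The random `k`-out graph: honest users select `k` other users uniformly at random and
independently; the selections of the malicious users have the joint law `Q`, independently of the
honest ones. The case where malicious users also follow the protocol is
`Q = PMF.uniformOfFinset (selections n k) _`. -/
def kOutGraph {n : ℕ} (H : Finset (Fin n)) (k : ℕ) (hk : k < n)
    (Q : PMF (Fin n → Finset (Fin n))) : PMF (SimpleGraph (Fin n)) :=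
  (PMF.uniformOfFinset (selections n k) (selections_nonempty hk)).bind fun S =>
    Q.map fun M => selectionGraph fun u => if u ∈ H then S u else M u

/-- The law of the adversary's view of the whole process: the graph is drawn from `P`, and then GOPA
is run on it. The draws of the malicious users may depend on the graph. -/
def gopaOnRandomGraph {n : ℕ} (P : PMF (SimpleGraph (Fin n))) (H : Finset (Fin n))
    (varEta varDelta : ℝ≥0) (ν : SimpleGraph (Fin n) → ProbabilityMeasure (Noise n))
    (X : Fin n → ℝ) : Measure (View n H) :=
  Measure.sum fun G => P G • gopa G H varEta varDelta (ν G : Measure (Noise n)) X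

/-- `(ε, δ)`-differential privacy of a mechanism `A` that maps the private values, which lie in
`[0, 1]`, to the law of its output; neighboring inputs differ only in the value of one honest
user. -/
def IsDP {n : ℕ} {Ω : Type*} [MeasurableSpace Ω] (H : Finset (Fin n)) (ε δ : ℝ)
    (A : (Fin n → ℝ) → Measure Ω) : Prop :=
  ∀ v ∈ H, ∀ X X' : Fin n → ℝ,
    (∀ u, X u ∈ Set.Icc (0 : ℝ) 1) → (∀ u, X' u ∈ Set.Icc (0 : ℝ) 1) →
    (∀ u, u ≠ v → X u = X' u) →
    ∀ O : Set Ω, MeasurableSet O →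
      A X O ≤ ENNReal.ofReal (Real.exp ε) * A X' O + ENNReal.ofReal δ

end

end Gopa

/-! ### Translates of Gaussian product measures and the tail of the privacy loss. -/

namespace Gopa

/-! Write `m` for the number of honest users. With the malicious draws fixed, what remains is a
Gaussian mechanism. If `X` and `X'` differ by `a` at the honest user `v`, the view does not change
when `X` is replaced by `X'` and the honest noise is translated: every honest `η_u` by `a / m`, and
the pairwise noise by `a` times an antisymmetric flow on the honest edges that spreads one unit from
`v` evenly over the honest users (`view_merge_add`). So a product Gaussian law has to be compared
with its translate. The privacy loss is Gaussian with mean `q / 2` and variance `q`, where `q ≤ 1 /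
(m σ_η²) + E / σ_Δ²` and `E` is the energy of the flow; `gaussianReal_privacyLoss_tail_le` bounds
its tail. If `E ≤ B` and `σ_Δ² = κ σ_η² m B`, then `q ≤ (1 + 1/κ) ε² / c²`. Thus `c²` is effectively
replaced by `κ/(κ+1) c²`, which turns `δ'` into `1.25 (δ'/1.25)^(κ/(κ+1))`.

It remains to bound `E`. The flow is taken to be the electrical current of a potential `f`, for
which `E` is `f v` minus the mean of `f` (`energy_eq`). On a complete graph a point potential gives
`E ≤ 1/m`. In general, rank the vertices by decreasing potential: the current leaving a top set is
at most 1 and crosses all edges to lower ranks, so many edges force a small drop. In a connected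
graph there is at least one edge at every rank, and adding the drops gives `E ≤ m/3`. In an
expanding graph the ranks are doubled up to the median: the drop from rank about `2^j` to `2^(j+1)`
is about `1 / (τ 2^j)`, a geometric series with sum at most `2/τ`, up to a term of order `log m / (τ
m)`. The lower half is climbed in the same way with `-f`.

For the random `k`-out graph, the generating function of the number of edges between two disjoint
sets is at most the binomial one, because a uniform `k`-subset is negatively correlated
(`sum_pow_edgeCount_le`). A Chernoff bound and a union bound over all relevant cuts show that the
honest subgraph is expanding except with probability `2δ/3`; the Gaussian mechanism uses the
remaining `δ/3`. -/

theorem gaussianReal_eq_withDensity (h : ℝ) {v : ℝ≥0} (hv : v ≠ 0) :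
    gaussianReal h v = (gaussianReal 0 v).withDensity
      fun x => ENNReal.ofReal (Real.exp (h * x / v - h ^ 2 / (2 * v))) := by
  rw [gaussianReal_of_var_ne_zero _ hv, gaussianReal_of_var_ne_zero _ hv,
    ← withDensity_mul _ (measurable_gaussianPDF _ _) (by fun_prop)]
  congr 1
  ext x
  simp only [Pi.mul_apply, gaussianPDF, gaussianPDFReal]
  rw [← ENNReal.ofReal_mul (by positivity), mul_assoc (√(2 * Real.pi * v))⁻¹, ← Real.exp_add]
  have : (v : ℝ) ≠ 0 := by exact_mod_cast hv
  congr 3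
  field_simp
  ring

/-- The Cameron–Martin formula in finite dimension. The density is a product over coordinates, so it
suffices to compare both measures on boxes. -/
theorem map_add_pi_gaussianReal {ι : Type*} [Fintype ι] (v : ι → ℝ≥0) (hv : ∀ i, v i ≠ 0)
    (h : ι → ℝ) :
    (Measure.pi fun i => gaussianReal 0 (v i)).map (fun x => x + h) =
      (Measure.pi fun i => gaussianReal 0 (v i)).withDensity
        fun x => ENNReal.ofReal (Real.exp (∑ i, (h i * x i / v i - h i ^ 2 / (2 * v i)))) := by
  have h1 : (Measure.pi fun i => gaussianReal 0 (v i)).map (fun x => x + h) =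
      Measure.pi fun i => gaussianReal (h i) (v i) := by
    have := Measure.pi_map_pi (μ := fun i => gaussianReal 0 (v i)) (f := fun i x => x + h i)
      (fun i => by fun_prop)
    simp only [gaussianReal_map_add_const, zero_add] at this
    exact this
  rw [h1]
  refine Measure.pi_eq fun s hs => ?_
  rw [withDensity_apply _ (MeasurableSet.univ_pi hs), ← lintegral_indicator (MeasurableSet.univ_pi hs)]
  have h2 : ∀ x : ι → ℝ, (Set.univ.pi s).indicator (fun x => ENNReal.ofReal
      (Real.exp (∑ i, (h i * x i / v i - h i ^ 2 / (2 * v i))))) x =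
      ∏ i, (s i).indicator (fun y => ENNReal.ofReal
        (Real.exp (h i * y / v i - h i ^ 2 / (2 * v i)))) (x i) := by
    intro x
    by_cases hx : x ∈ Set.univ.pi s
    · rw [Set.indicator_of_mem hx, Real.exp_sum, ENNReal.ofReal_prod_of_nonneg
        (fun i _ => (Real.exp_pos _).le)]
      refine Finset.prod_congr rfl fun i _ => ?_
      rw [Set.indicator_of_mem (hx i trivial)]
    · rw [Set.indicator_of_notMem hx]
      obtain ⟨i, hi⟩ : ∃ i, x i ∉ s i := by simpa [Set.mem_univ_pi] using hx
      exact (Finset.prod_eq_zero (Finset.mem_univ i) (Set.indicator_of_notMem hi _)).symm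
  simp_rw [h2]
  have hm : ∀ i, Measurable ((s i).indicator (fun y => ENNReal.ofReal
        (Real.exp (h i * y / v i - h i ^ 2 / (2 * v i))))) := fun i =>
    Measurable.indicator (by fun_prop) (hs i)
  rw [lintegral_prod_eq_prod_lintegral_of_indepFun Finset.univ
    (fun i (x : ι → ℝ) => (s i).indicator (fun y => ENNReal.ofReal
        (Real.exp (h i * y / v i - h i ^ 2 / (2 * v i)))) (x i))
    (iIndepFun_pi fun i => (hm i).aemeasurable) (fun i => (hm i).comp (measurable_pi_apply i))]
  refine Finset.prod_congr rfl fun i _ => ?_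
  have h3 := (measurePreserving_eval (fun i => gaussianReal 0 (v i)) i).lintegral_comp (hm i)
  simp only [Function.eval] at h3
  rw [h3, lintegral_indicator (hs i), gaussianReal_eq_withDensity (h i) (hv i),
    withDensity_apply _ (hs i)]

theorem map_sum_mul_pi_gaussianReal {ι : Type*} [Fintype ι] (v : ι → ℝ≥0) (b : ι → ℝ) :
    (Measure.pi fun i => gaussianReal 0 (v i)).map (fun x => ∑ i, b i * x i) =
      gaussianReal 0 (∑ i, b i ^ 2 * v i).toNNReal := by
  set P := Measure.pi fun i => gaussianReal 0 (v i) with hP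
  have hind : iIndepFun (fun i (x : ι → ℝ) => b i * x i) P :=
    iIndepFun_pi (X := fun i y => b i * y) fun i => by fun_prop
  have hL : ∀ i, HasGaussianLaw (fun x : ι → ℝ => b i * x i) P := by
    intro i
    refine ⟨?_⟩
    have : P.map (fun x : ι → ℝ => b i * x i) =
        (gaussianReal 0 (v i)).map (fun y => b i * y) := by
      rw [← (measurePreserving_eval (fun i => gaussianReal 0 (v i)) i).map_eq,
        Measure.map_map (by fun_prop) (by fun_prop)]
      rfl
    rw [this, gaussianReal_map_const_mul]
    infer_instance
  have hsum := hind.hasGaussianLaw_fun_sum hL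
  rw [hsum.map_eq_gaussianReal]
  congr 1
  · rw [integral_finsetSum]
    · refine Finset.sum_eq_zero fun i _ => ?_
      rw [integral_const_mul]
      have := integral_comp_eval (μ := fun i => gaussianReal 0 (v i)) (i := i) (f := fun y : ℝ => y)
        (by fun_prop)
      rw [hP, this]
      simp
    · intro i _
      exact (hL i).integrable
  · congr 1
    have := variance_sum_pi (μ := fun i => gaussianReal 0 (v i)) (X := fun i y => b i * y)
      (fun i => (memLp_id_gaussianReal 2).const_mul _)
    have e : (fun ω : ι → ℝ => ∑ i, b i * ω i) = ∑ i, fun ω : ι → ℝ => b i * ω i := by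
      ext; simp
    rw [e, hP, this]
    refine Finset.sum_congr rfl fun i _ => ?_
    rw [variance_const_mul, variance_fun_id_gaussianReal]

/-- Comparison of a Gaussian product measure with its translate. -/
theorem map_add_pi_gaussianReal_le {ι : Type*} [Fintype ι] (v : ι → ℝ≥0) (hv : ∀ i, v i ≠ 0)
    (h : ι → ℝ) (ε : ℝ) {S : Set (ι → ℝ)} (hS : MeasurableSet S) :
    (Measure.pi fun i => gaussianReal 0 (v i)).map (fun x => x + h) S ≤
      ENNReal.ofReal (Real.exp ε) * (Measure.pi fun i => gaussianReal 0 (v i)) S +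
        gaussianReal 0 (∑ i, h i ^ 2 / v i).toNNReal (Set.Ioi (ε - (∑ i, h i ^ 2 / v i) / 2)) := by
  set P := Measure.pi fun i => gaussianReal 0 (v i) with hP
  -- `L` is the privacy loss, the logarithm of the density of the translate. Where `L ≤ ε` the
  -- density costs a factor `exp ε`; the rest of `S` is charged to the tail.
  set L : (ι → ℝ) → ℝ := fun x => ∑ i, (h i * x i / v i - h i ^ 2 / (2 * v i)) with hLdef
  have hLm : Measurable L := by rw [hLdef]; fun_prop
  have hv' : ∀ i, (v i : ℝ) ≠ 0 := fun i => by exact_mod_cast hv i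
  have hT : MeasurableSet {x | L x ≤ ε} := measurableSet_le hLm measurable_const
  calc P.map (fun x => x + h) S
      ≤ P.map (fun x => x + h) (S ∩ {x | L x ≤ ε}) + P.map (fun x => x + h) {x | L x ≤ ε}ᶜ := by
        refine (measure_mono ?_).trans (measure_union_le _ _)
        intro x hx
        by_cases hxL : L x ≤ ε
        · exact Or.inl ⟨hx, hxL⟩
        · exact Or.inr hxL
    _ ≤ _ := by
        refine add_le_add ?_ (le_of_eq ?_)
        · rw [hP, map_add_pi_gaussianReal v hv h, ← hP, withDensity_apply _ (hS.inter hT)]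
          calc _ ≤ ∫⁻ _ in S ∩ {x | L x ≤ ε}, ENNReal.ofReal (Real.exp ε) ∂P := by
                refine setLIntegral_mono measurable_const fun x hx => ?_
                exact ENNReal.ofReal_le_ofReal (Real.exp_le_exp.2 hx.2)
            _ ≤ _ := by
                rw [setLIntegral_const]
                gcongr
                exact Set.inter_subset_left
        · have hq : ∑ i, h i ^ 2 / v i = ∑ i, (h i / v i) ^ 2 * v i :=
            Finset.sum_congr rfl fun i _ => by have := hv' i; field_simp
          rw [Measure.map_apply (by fun_prop) hT.compl, hq,
            ← map_sum_mul_pi_gaussianReal v (fun i => h i / v i), ← hq,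
            Measure.map_apply (by fun_prop) measurableSet_Ioi]
          congr 1
          ext x
          -- Under the translated law the loss is a centred Gaussian of variance `q` plus `q / 2`.
          have : L (x + h) = ∑ i, h i / v i * x i + (∑ i, h i ^ 2 / v i) / 2 := by
            rw [hLdef]
            simp only [Pi.add_apply]
            rw [Finset.sum_div, ← Finset.sum_add_distrib]
            refine Finset.sum_congr rfl fun i _ => ?_
            have := hv' i
            field_simp
            ring
          simp only [Set.mem_preimage, Set.mem_compl_iff, Set.mem_ofPred_eq, not_le, Set.mem_Ioi,
            this]
          constructor <;> intro h <;> linarith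

theorem gaussianReal_Ioi_zero_le (v : ℝ≥0) :
    gaussianReal 0 v (Set.Ioi 0) ≤ ENNReal.ofReal (1 / 2) := by
  have h1 : gaussianReal 0 v (Set.Iio 0) = gaussianReal 0 v (Set.Ioi 0) := by
    have := gaussianReal_map_neg (μ := 0) (v := v)
    rw [neg_zero] at this
    conv_lhs => rw [← this]
    rw [Measure.map_apply measurable_neg measurableSet_Iio]
    congr 1
    ext x
    simp
  have h2 : gaussianReal 0 v (Set.Iio 0) + gaussianReal 0 v (Set.Ioi 0) ≤ 1 := by
    rw [← measure_union (by
      rw [Set.disjoint_left]; intro x hx hx'; exact lt_asymm (Set.mem_Iio.1 hx) (Set.mem_Ioi.1 hx')) measurableSet_Ioi]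
    exact prob_le_one
  rw [h1, ← two_mul] at h2
  rw [ENNReal.ofReal_div_of_pos (by norm_num), ENNReal.ofReal_one, ENNReal.le_div_iff_mul_le
    (by simp) (by simp), mul_comm]
  simpa using h2

/-- Translating by `-s` moves the tail to the positive half-line, which has mass at most `1/2` and
on which the density of the translate is at most `exp (-s²/(2v))`. -/
theorem gaussianReal_Ioi_le_exp {v : ℝ≥0} (hv : v ≠ 0) {s : ℝ} (hs : 0 ≤ s) :
    gaussianReal 0 v (Set.Ioi s) ≤ ENNReal.ofReal (1 / 2 * Real.exp (-(s ^ 2 / (2 * v)))) := by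
  have hv' : (0 : ℝ) < v := by positivity
  have h1 : gaussianReal 0 v (Set.Ioi s) = gaussianReal (-s) v (Set.Ioi 0) := by
    have := gaussianReal_map_add_const (μ := 0) (v := v) (-s)
    rw [zero_add] at this
    rw [← this, Measure.map_apply (by fun_prop) measurableSet_Ioi]
    congr 1
    ext x
    simp
  rw [h1, gaussianReal_eq_withDensity _ hv, withDensity_apply _ measurableSet_Ioi]
  calc _ ≤ ∫⁻ _ in Set.Ioi 0, ENNReal.ofReal (Real.exp (-(s ^ 2 / (2 * v)))) ∂(gaussianReal 0 v) := by
        refine setLIntegral_mono measurable_const fun x hx => ?_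
        refine ENNReal.ofReal_le_ofReal (Real.exp_le_exp.2 ?_)
        have : 0 ≤ s * x / v := div_nonneg (mul_nonneg hs (le_of_lt hx)) hv'.le
        rw [neg_mul, neg_div, neg_sq]
        linarith
    _ ≤ _ := by
        rw [setLIntegral_const, mul_comm, ENNReal.ofReal_mul (by norm_num)]
        gcongr
        exact gaussianReal_Ioi_zero_le v

/-- The Gaussian density is at most `1 / (2√v)` because `2π ≥ 4`; this is applied on the interval
from `s` to `0`. -/
theorem gaussianReal_Ioi_le_of_nonpos {v : ℝ≥0} (hv : v ≠ 0) {s : ℝ} (hs : s ≤ 0) :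
    gaussianReal 0 v (Set.Ioi s) ≤ ENNReal.ofReal (1 / 2 + (-s) / 2 / √v) := by
  have hv' : (0 : ℝ) < v := by positivity
  have hsq : 0 < √(v : ℝ) := Real.sqrt_pos.2 hv'
  rw [← Set.Ioc_union_Ioi_eq_Ioi hs, add_comm, ENNReal.ofReal_add
    (div_nonneg (by linarith) hsq.le) (by norm_num)]
  refine (measure_union_le _ _).trans (add_le_add ?_ (gaussianReal_Ioi_zero_le v))
  rw [gaussianReal_apply _ hv]
  calc _ ≤ ∫⁻ _ in Set.Ioc s 0, ENNReal.ofReal (1 / 2 / √v) := by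
        refine setLIntegral_mono measurable_const fun x hx => ?_
        refine ENNReal.ofReal_le_ofReal ?_
        rw [gaussianPDFReal]
        calc _ ≤ (√(2 * Real.pi * v))⁻¹ * 1 := by
              gcongr
              rw [Real.exp_le_one_iff, neg_div]
              have : 0 ≤ (x - 0) ^ 2 / (2 * (v : ℝ)) := by positivity
              linarith
          _ ≤ _ := by
              rw [mul_one, div_div, ← one_div]
              refine one_div_le_one_div_of_le (by positivity) (Real.le_sqrt_of_sq_le ?_)
              rw [mul_pow, Real.sq_sqrt hv'.le]
              nlinarith [Real.pi_gt_three]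
    _ ≤ _ := by
        rw [setLIntegral_const, Real.volume_Ioc, ← ENNReal.ofReal_mul (by positivity)]
        refine ENNReal.ofReal_le_ofReal (le_of_eq ?_)
        ring

/-- The tail bound behind the analysis of the Gaussian mechanism. -/
theorem gaussianReal_privacyLoss_tail_le {ε δ C : ℝ} (hε0 : 0 < ε) (hε1 : ε < 1) (hδ0 : 0 < δ)
    (hδ1 : δ < 1) (hC : 2 * Real.log (1.25 / δ) < C) (q : ℝ≥0) (hq : (q : ℝ) * C ≤ ε ^ 2) :
    gaussianReal 0 q (Set.Ioi (ε - q / 2)) ≤ ENNReal.ofReal δ := by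
  have hδexp : 1.25 * Real.exp (-(C / 2)) ≤ δ := by
    have h1 : Real.exp (Real.log (1.25 / δ)) ≤ Real.exp (C / 2) := Real.exp_le_exp.2 (by linarith)
    rw [Real.exp_log (by positivity), div_le_iff₀ hδ0] at h1
    rw [Real.exp_neg, ← div_eq_mul_inv, div_le_iff₀ (Real.exp_pos _)]
    linarith
  -- Since `δ < 1`, `C` exceeds `2 log 1.25 ≥ 2 (1 - 1/1.25)`.
  have hC0 : 0.4 < C := by
    have : Real.log 1.25 < Real.log (1.25 / δ) :=
      Real.log_lt_log (by norm_num) (by rw [lt_div_iff₀ hδ0]; linarith)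
    have h2 : 1 - 1.25⁻¹ ≤ Real.log 1.25 := Real.one_sub_inv_le_log_of_pos (by norm_num)
    norm_num at h2 this hC ⊢
    linarith
  rcases eq_or_ne q 0 with rfl | hq0
  · rw [gaussianReal_zero_var]
    have : (0 : ℝ) ∉ Set.Ioi (ε - ((0 : ℝ≥0) : ℝ) / 2) := by simpa using hε0.le
    rw [Measure.dirac_apply' _ measurableSet_Ioi, Set.indicator_of_notMem this]
    exact bot_le
  have hqpos : (0 : ℝ) < q := by positivity
  rcases le_total 0 (ε - q / 2) with hs | hs
  · refine (gaussianReal_Ioi_le_exp hq0 hs).trans (ENNReal.ofReal_le_ofReal (le_trans ?_ hδexp))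
    -- Expanding the square gives `ε²/(2q) - ε/2 + q/8`, where `ε²/q ≥ C` and `ε < 1`. The loss of
    -- `exp (1/2)` is covered by the constant: `exp (1/2) / 2 ≤ 1.25`.
    have h1 : C / 2 - 1 / 2 ≤ (ε - q / 2) ^ 2 / (2 * q) := by
      rw [le_div_iff₀ (by positivity)]
      nlinarith [sq_nonneg (q : ℝ)]
    calc 1 / 2 * Real.exp (-((ε - q / 2) ^ 2 / (2 * q)))
        ≤ 1 / 2 * (Real.exp (1 / 2) * Real.exp (-(C / 2))) := by
          rw [← Real.exp_add]
          gcongr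
          linarith
      _ ≤ _ := by
          have : Real.exp (1 / 2) ≤ 2.5 := by
            have h := Real.exp_one_lt_d9
            have h' : Real.exp (1 / 2) ≤ Real.exp 1 := Real.exp_le_exp.2 (by norm_num)
            have h3 : Real.exp (1 / 2) * Real.exp (1 / 2) = Real.exp 1 := by
              rw [← Real.exp_add]; norm_num
            nlinarith [Real.exp_pos (1 / 2)]
          nlinarith [Real.exp_pos (-(C / 2))]
  · refine (gaussianReal_Ioi_le_of_nonpos hq0 hs).trans (ENNReal.ofReal_le_ofReal ?_)
    -- Here `q ≥ 2ε`, so `C ≤ ε²/q ≤ ε/2`. Then `δ` is so large that a tail bound of `1/2 + 1/4`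
    -- suffices.
    have hCle : C ≤ 1 / 2 := by
      by_contra hcon
      push Not at hcon
      nlinarith
    have hδ' : 0.75 ≤ δ := by
      have := Real.add_one_le_exp (-(C / 2))
      norm_num at *
      linarith
    have hsq : 0 < √(q : ℝ) := Real.sqrt_pos.2 hqpos
    have hsq2 : √(q : ℝ) ^ 2 = q := Real.sq_sqrt hqpos.le
    -- From `0.4 q ≤ ε²`, as `0.63² < 0.4`.
    have h1 : √(q : ℝ) * 0.63 ≤ ε := by
      nlinarith
    have : -(ε - q / 2) / 2 / √(q : ℝ) ≤ 0.25 := by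
      rw [div_le_iff₀ hsq]
      nlinarith
    norm_num at *
    linarith

theorem map_add_pi_gaussianReal_le_of_sum_le {ι : Type*} [Fintype ι] (v : ι → ℝ≥0)
    (hv : ∀ i, v i ≠ 0) (h : ι → ℝ) {ε δ C : ℝ} (hε0 : 0 < ε) (hε1 : ε < 1) (hδ0 : 0 < δ)
    (hC : 2 * Real.log (1.25 / δ) < C) (hq : (∑ i, h i ^ 2 / v i) * C ≤ ε ^ 2)
    {S : Set (ι → ℝ)} (hS : MeasurableSet S) :
    (Measure.pi fun i => gaussianReal 0 (v i)).map (fun x => x + h) S ≤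
      ENNReal.ofReal (Real.exp ε) * (Measure.pi fun i => gaussianReal 0 (v i)) S +
        ENNReal.ofReal δ := by
  have h0 : 0 ≤ ∑ i, h i ^ 2 / v i := Finset.sum_nonneg fun i _ => by positivity
  rcases lt_or_ge δ 1 with hδ1 | hδ1
  · refine (map_add_pi_gaussianReal_le v hv h ε hS).trans ?_
    gcongr
    have := gaussianReal_privacyLoss_tail_le hε0 hε1 hδ0 hδ1 hC (∑ i, h i ^ 2 / v i).toNNReal
      (by rwa [Real.coe_toNNReal _ h0])
    rwa [Real.coe_toNNReal _ h0] at this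
  · have : IsProbabilityMeasure ((Measure.pi fun i => gaussianReal 0 (v i)).map (fun x => x + h)) :=
      Measure.isProbabilityMeasure_map (by fun_prop)
    refine prob_le_one.trans (le_trans ?_ le_add_self)
    rwa [ENNReal.one_le_ofReal]

theorem protocolNoise_map_add_le {n : ℕ} {varEta varDelta : ℝ≥0} (hE : varEta ≠ 0)
    (hD : varDelta ≠ 0) (h : Noise n) {ε δ C : ℝ} (hε0 : 0 < ε) (hε1 : ε < 1) (hδ0 : 0 < δ)
    (hC : 2 * Real.log (1.25 / δ) < C)
    (hq : ((∑ u, h.1 u ^ 2) / varEta + (∑ e, h.2 e ^ 2) / varDelta) * C ≤ ε ^ 2)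
    {S : Set (Noise n)} (hS : MeasurableSet S) :
    (protocolNoise n varEta varDelta).map (fun x => x + h) S ≤
      ENNReal.ofReal (Real.exp ε) * protocolNoise n varEta varDelta S + ENNReal.ofReal δ := by
  -- Both families of draws form a single Gaussian product indexed by the disjoint union.
  set v : Fin n ⊕ Sym2 (Fin n) → ℝ≥0 := Sum.elim (fun _ => varEta) (fun _ => varDelta) with hv
  have hmp := measurePreserving_sumPiEquivProdPi (fun i => gaussianReal 0 (v i))
  have hP : protocolNoise n varEta varDelta = (Measure.pi fun i => gaussianReal 0 (v i)).map
      (MeasurableEquiv.sumPiEquivProdPi fun _ => ℝ) := hmp.map_eq.symm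
  have hm := hmp.measurable
  have key := map_add_pi_gaussianReal_le_of_sum_le v
    (by rintro (i | i) <;> simpa [hv]) (Sum.elim h.1 h.2) hε0 hε1 hδ0 hC
    (by simpa [Fintype.sum_sum_type, hv, Finset.sum_div] using hq) (hm hS)
  rw [hP, Measure.map_map (by fun_prop) hm, Measure.map_apply hm hS,
    Measure.map_apply ((by fun_prop : Measurable fun x : Noise n => x + h).comp hm) hS]
  rw [Measure.map_apply (by fun_prop) (hm hS)] at key
  exact key

/-! ### Absorbing a change of the input into a translation of the noise. -/

/-- The shift of the pairwise draws that changes every `Δ_{u,v}` by `g u v`. -/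
noncomputable def pairShift {n : ℕ} (g : Fin n → Fin n → ℝ) (e : Sym2 (Fin n)) : ℝ :=
  Sym2.lift ⟨fun u w => if u < w then g u w else g w u, by
    intro u w
    rcases lt_trichotomy u w with h | rfl | h
    · simp [h, h.not_gt]
    · rfl
    · simp [h, h.not_gt]⟩ e

theorem pairShift_of_lt {n : ℕ} (g : Fin n → Fin n → ℝ) {u w : Fin n} (h : u < w) :
    pairShift g s(u, w) = g u w := by
  simp [pairShift, h]

theorem pairShift_of_not_lt {n : ℕ} (g : Fin n → Fin n → ℝ) {u w : Fin n} (h : ¬ u < w) :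
    pairShift g s(u, w) = g w u := by
  simp [pairShift, h]

/-- The double sum meets every unordered pair twice, with equal squares, and antisymmetry kills the
diagonal. -/
theorem sum_pairShift_sq {n : ℕ} (g : Fin n → Fin n → ℝ) (hanti : ∀ u w, g w u = - g u w) :
    ∑ e, pairShift g e ^ 2 = (∑ u, ∑ w, g u w ^ 2) / 2 := by
  classical
  have hdiag : ∀ u, g u u = 0 := fun u => by linarith [hanti u u]
  have h1 : ∑ e, pairShift g e ^ 2 =
      ∑ e ∈ (Finset.univ : Finset (Fin n)).sym2 with ¬ e.IsDiag, pairShift g e ^ 2 := by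
    rw [Finset.sym2_univ]
    refine (Finset.sum_filter_of_ne (p := fun e : Sym2 (Fin n) => ¬ e.IsDiag) fun e _ he hd => he ?_).symm
    induction e with
    | _ u w =>
      obtain rfl : u = w := by simpa using hd
      rw [pairShift_of_not_lt g (lt_irrefl u), hdiag]
      simp
  have h2 : ∑ p ∈ (Finset.univ : Finset (Fin n)).offDiag with p.1 < p.2, pairShift g s(p.1, p.2) ^ 2
      = ∑ u, ∑ w, if u < w then g u w ^ 2 else 0 := by
    rw [← Finset.sum_product', ← Finset.sum_filter]
    refine Finset.sum_congr ?_ fun p hp => ?_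
    · ext p
      simp only [Finset.mem_filter, Finset.mem_offDiag, Finset.mem_univ, true_and,
        Finset.mem_product, and_self]
      exact ⟨fun h => h.2, fun h => ⟨h.ne, h⟩⟩
    · rw [pairShift_of_lt g (Finset.mem_filter.1 hp).2]
  have h3 : ∑ u, ∑ w, g u w ^ 2 =
      (∑ u, ∑ w, if u < w then g u w ^ 2 else 0) + ∑ u, ∑ w, if w < u then g u w ^ 2 else 0 := by
    rw [← Finset.sum_add_distrib]
    refine Finset.sum_congr rfl fun u _ => ?_
    rw [← Finset.sum_add_distrib]
    refine Finset.sum_congr rfl fun w _ => ?_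
    rcases lt_trichotomy u w with h | rfl | h
    · simp [h, h.not_gt]
    · simp [hdiag]
    · simp [h, h.not_gt]
  have h4 : (∑ u, ∑ w, if w < u then g u w ^ 2 else 0) =
      ∑ u, ∑ w, if u < w then g u w ^ 2 else 0 := by
    rw [Finset.sum_comm]
    refine Finset.sum_congr rfl fun u _ => Finset.sum_congr rfl fun w _ => ?_
    rw [hanti u w, neg_sq]
  rw [h1, Finset.sum_sym2_filter_not_isDiag, h2, h3, h4]
  ring

/-- Changing the private values of honest users by a vector that the noise can absorb does not
change the view. -/
theorem view_merge_add {n : ℕ} (G : SimpleGraph (Fin n)) (H : Finset (Fin n))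
    (X X' : Fin n → ℝ) (s : Fin n → ℝ) (g : Fin n → Fin n → ℝ)
    (hanti : ∀ u w, g w u = - g u w)
    (hsupp : ∀ u w, ¬ (u ∈ H ∧ w ∈ H ∧ G.Adj u w) → g u w = 0)
    (hmal : ∀ u, u ∉ H → X u = X' u)
    (hX : ∀ u ∈ H, X u = X' u + ∑ w, g u w + s u) (ω α : Noise n) :
    view G H X (merge H ω α) = view G H X' (merge H (ω + (s, pairShift g)) α) := by
  classical
  have hpair : ∀ u w, pairNoise G (merge H (ω + (s, pairShift g)) α) u w =
      pairNoise G (merge H ω α) u w + g u w := by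
    intro u w
    by_cases hadj : G.Adj u w
    · by_cases hH : u ∈ H ∧ w ∈ H
      · have h1 : ∀ x ∈ s(u, w), x ∈ H := by simpa using hH
        simp only [pairNoise, hadj, if_true, merge, if_pos h1]
        by_cases hlt : u < w
        · simp [hlt, pairShift_of_lt g hlt]
        · simp only [hlt, if_false, Prod.snd_add, Pi.add_apply, pairShift_of_not_lt g hlt,
            hanti u w]
          ring
      · have h1 : ¬ ∀ x ∈ s(u, w), x ∈ H := by simpa using hH
        rw [hsupp u w (fun h => hH ⟨h.1, h.2.1⟩), add_zero]
        simp only [pairNoise, hadj, if_true, merge, if_neg h1]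
    · rw [hsupp u w (fun h => hadj h.2.2), add_zero]
      simp only [pairNoise, hadj, if_false]
  unfold view
  refine Prod.ext rfl (Prod.ext ?_ (Prod.ext ?_ (Prod.ext ?_ ?_)))
  · ext u
    simp only [noisyValue, hpair, Finset.sum_add_distrib]
    have hsum : ∑ w ∈ G.neighborFinset u, g u w = ∑ w, g u w := by
      refine Finset.sum_subset (Finset.subset_univ _) fun w _ hw => hsupp u w fun h => hw ?_
      simpa using h.2.2
    rw [hsum]
    by_cases hu : u ∈ H
    · simp only [merge, hu, if_true, Prod.fst_add, Pi.add_apply, hX u hu]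
      ring
    · rw [Finset.sum_eq_zero fun w _ => hsupp u w fun h => hu h.1, hmal u hu]
      simp [merge, hu]
  · ext u
    exact hmal u u.2
  · ext u
    simp [merge, u.2]
  · ext p
    simp only [hpair]
    rw [hsupp p.1.1 p.1.2 (fun h => p.2.elim (fun h' => h' h.1) (fun h' => h' h.2.1)), add_zero]

/-- Privacy depends on the graph only through the energy of one flow: the uniform part `1 / H.card`
of the unit at `v` is carried by the `η_u`, and the rest by the pairwise noise. -/
theorem gopa_le_of_flow {n : ℕ} (G : SimpleGraph (Fin n)) (H : Finset (Fin n)) {v : Fin n}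
    (hv : v ∈ H) (g : Fin n → Fin n → ℝ) (hanti : ∀ u w, g w u = - g u w)
    (hsupp : ∀ u w, ¬ (u ∈ H ∧ w ∈ H ∧ G.Adj u w) → g u w = 0)
    (hdiv : ∀ u ∈ H, ∑ w, g u w = (if u = v then 1 else 0) - 1 / (H.card : ℝ))
    {varEta varDelta : ℝ≥0} (hE : varEta ≠ 0) (hD : varDelta ≠ 0) {ε δ C : ℝ} (hε0 : 0 < ε)
    (hε1 : ε < 1) (hδ0 : 0 < δ) (hC : 2 * Real.log (1.25 / δ) < C) (hC0 : 0 ≤ C)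
    (hq : (1 / H.card / varEta + (∑ u, ∑ w, g u w ^ 2) / 2 / varDelta) * C ≤ ε ^ 2)
    (ν : ProbabilityMeasure (Noise n)) {X X' : Fin n → ℝ}
    (hX : ∀ u, X u ∈ Set.Icc (0 : ℝ) 1) (hX' : ∀ u, X' u ∈ Set.Icc (0 : ℝ) 1)
    (hXX' : ∀ u, u ≠ v → X u = X' u) {O : Set (View n H)} (hO : MeasurableSet O) :
    gopa G H varEta varDelta ν X O ≤
      ENNReal.ofReal (Real.exp ε) * gopa G H varEta varDelta ν X' O + ENNReal.ofReal δ := by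
  classical
  have hm : (0 : ℝ) < H.card := by exact_mod_cast Finset.card_pos.2 ⟨v, hv⟩
  -- Both values lie in `[0, 1]`, so the squared length of the translation is at most that for a
  -- unit change.
  set a := X v - X' v with ha
  have ha1 : a ^ 2 ≤ 1 := by
    have h1 := hX v; have h2 := hX' v
    rw [sq_le_one_iff_abs_le_one, abs_le]
    constructor <;> linarith [h1.1, h1.2, h2.1, h2.2]
  set s : Fin n → ℝ := fun u => if u ∈ H then a / H.card else 0 with hs
  set g' : Fin n → Fin n → ℝ := fun u w => a * g u w with hg'
  have hview : ∀ ω α, view G H X (merge H ω α) = view G H X' (merge H (ω + (s, pairShift g')) α) := by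
    refine view_merge_add G H X X' s g' (fun u w => by simp only [hg', hanti u w]; ring)
      (fun u w h => by simp only [hg', hsupp u w h, mul_zero]) ?_ ?_
    · intro u hu
      exact hXX' u (fun h => hu (h ▸ hv))
    · intro u hu
      simp only [hg', ← Finset.mul_sum, hdiv u hu, hs, hu, if_true]
      by_cases huv : u = v
      · subst huv; simp only [if_true, ha]; ring
      · simp only [huv, if_false, hXX' u huv]; ring
  have hP : IsProbabilityMeasure (protocolNoise n varEta varDelta) := by
    unfold protocolNoise; infer_instance
  have hshift : ∀ S : Set (Noise n), MeasurableSet S →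
      (protocolNoise n varEta varDelta).map (fun x => x + (s, pairShift g')) S ≤
      ENNReal.ofReal (Real.exp ε) * protocolNoise n varEta varDelta S + ENNReal.ofReal δ := by
    intro S hS
    refine protocolNoise_map_add_le hE hD (s, pairShift g') hε0 hε1 hδ0 hC ?_ hS
    have e1 : ∑ u, s u ^ 2 = a ^ 2 * (1 / H.card) := by
      simp only [hs, ite_pow, ne_eq, OfNat.ofNat_ne_zero, not_false_eq_true, zero_pow,
        Finset.sum_ite_mem, Finset.univ_inter, Finset.sum_const, nsmul_eq_mul]
      rw [div_pow, mul_div_assoc', mul_comm, sq (H.card : ℝ), mul_div_mul_right _ _ hm.ne',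
        mul_one_div]
    have e2 : ∑ e, pairShift g' e ^ 2 = a ^ 2 * ((∑ u, ∑ w, g u w ^ 2) / 2) := by
      rw [sum_pairShift_sq g' (fun u w => by simp only [hg', hanti u w]; ring)]
      simp only [hg', mul_pow, ← Finset.mul_sum]
      ring
    simp only [e1, e2]
    have h0 : 0 ≤ (1 / H.card / varEta + (∑ u, ∑ w, g u w ^ 2) / 2 / varDelta) * C := by
      refine mul_nonneg (add_nonneg (div_nonneg (div_nonneg zero_le_one hm.le) varEta.2) ?_) hC0
      exact div_nonneg (div_nonneg (Finset.sum_nonneg fun u _ => Finset.sum_nonneg fun w _ =>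
        sq_nonneg _) zero_le_two) varDelta.2
    calc _ = a ^ 2 * ((1 / H.card / varEta + (∑ u, ∑ w, g u w ^ 2) / 2 / varDelta) * C) := by ring
      _ ≤ 1 * ((1 / H.card / varEta + (∑ u, ∑ w, g u w ^ 2) / 2 / varDelta) * C) :=
        mul_le_mul_of_nonneg_right ha1 h0
      _ ≤ _ := by rwa [one_mul]
  unfold gopa
  have hmX := measurable_view G H X
  have hmX' := measurable_view G H X'
  rw [Measure.map_apply hmX hO, Measure.map_apply hmX' hO, Measure.prod_apply_symm (hmX hO),
    Measure.prod_apply_symm (hmX' hO)]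
  have hmeas' : ∀ α : Noise n, MeasurableSet {ω | view G H X' (merge H ω α) ∈ O} := fun α =>
    (hmX'.comp (measurable_id.prodMk measurable_const)) hO
  -- The translation does not depend on the malicious draws `α`, so the bound holds for each `α` and
  -- is integrated; this is why their joint law may be arbitrary.
  calc _ ≤ ∫⁻ α, (ENNReal.ofReal (Real.exp ε) * protocolNoise n varEta varDelta
          {ω | view G H X' (merge H ω α) ∈ O} + ENNReal.ofReal δ) ∂(ν : Measure (Noise n)) := by
        refine lintegral_mono fun α => ?_
        refine le_trans (le_of_eq ?_) (hshift _ (hmeas' α))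
        rw [Measure.map_apply (by fun_prop) (hmeas' α)]
        congr 1
        ext ω
        simp only [Set.mem_preimage, Set.mem_ofPred_eq, hview]
    _ = _ := by
        rw [lintegral_add_right _ measurable_const, lintegral_const_mul]
        · simp
          rfl
        · exact measurable_measure_prodMk_right (hmX' hO)

/-! ### Electrical flows and level sets of potentials. -/

open Classical in
/-- The potential difference along the edge from `u` to `w`. -/
noncomputable def edgeFlow {V : Type*} (G : SimpleGraph V) (f : V → ℝ) (u w : V) : ℝ :=
  if G.Adj u w then f u - f w else 0

open Classical in
/-- The number of pairs in `A × C` that are adjacent. -/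
noncomputable def edgeCount {V : Type*} (G : SimpleGraph V) (A C : Finset V) : ℕ :=
  ((A ×ˢ C).filter fun p => G.Adj p.1 p.2).card

section Potential

variable {V : Type*} (G : SimpleGraph V)

theorem edgeFlow_antisymm (f : V → ℝ) (u w : V) : edgeFlow G f w u = - edgeFlow G f u w := by
  by_cases h : G.Adj u w
  · simp [edgeFlow, h, h.symm]
  · have h' : ¬ G.Adj w u := fun h' => h h'.symm
    simp [edgeFlow, h, h']

theorem sum_edgeFlow_self (f : V → ℝ) (A : Finset V) :
    ∑ u ∈ A, ∑ w ∈ A, edgeFlow G f u w = 0 := by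
  have h : ∑ u ∈ A, ∑ w ∈ A, edgeFlow G f u w = - ∑ u ∈ A, ∑ w ∈ A, edgeFlow G f u w := by
    conv_lhs => rw [Finset.sum_comm]
    simp_rw [← Finset.sum_neg_distrib]
    exact Finset.sum_congr rfl fun u _ => Finset.sum_congr rfl fun w _ => edgeFlow_antisymm G f u w
  linarith

/-- Discrete Green identity: summation by parts, using the antisymmetry of the current. -/
theorem sum_edgeFlow_sq [Fintype V] (f : V → ℝ) :
    (∑ u, ∑ w, edgeFlow G f u w ^ 2) / 2 = ∑ u, f u * ∑ w, edgeFlow G f u w := by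
  have h1 : ∀ u w, edgeFlow G f u w ^ 2 = f u * edgeFlow G f u w + f w * edgeFlow G f w u := by
    intro u w
    rw [edgeFlow_antisymm G f u w]
    unfold edgeFlow
    split_ifs <;> ring
  simp_rw [h1, Finset.sum_add_distrib]
  rw [Finset.sum_comm (f := fun u w => f w * edgeFlow G f w u)]
  simp_rw [Finset.mul_sum]
  ring

theorem edgeFlow_neg (f : V → ℝ) (u w : V) : edgeFlow G (-f) u w = - edgeFlow G f u w := by
  unfold edgeFlow
  split_ifs <;> (simp; try ring)

/-- A unit current can be sent from any vertex of a connected graph to the uniform distribution. -/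
theorem exists_potential [Fintype V] (hG : G.Connected) (b : V → ℝ) (hb : ∑ u, b u = 0) :
    ∃ f : V → ℝ, ∀ u, ∑ w, edgeFlow G f u w = b u := by
  classical
  have hne := hG.nonempty
  have hcard : (Fintype.card V : ℝ) ≠ 0 := by exact_mod_cast Fintype.card_ne_zero
  -- The graph Laplacian plus the all-ones operator. The added sum removes the constants from the
  -- kernel: if `T f = 0`, then `f` has sum zero and energy zero, hence is constant by connectedness
  -- and so vanishes.
  let T : (V → ℝ) →ₗ[ℝ] (V → ℝ) :=
    { toFun := fun f u => ∑ w, edgeFlow G f u w + ∑ w, f w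
      map_add' := by
        intro f g
        ext u
        simp only [Pi.add_apply, edgeFlow, Finset.sum_add_distrib]
        have : ∑ w, (if G.Adj u w then f u + g u - (f w + g w) else 0) =
            ∑ w, (if G.Adj u w then f u - f w else 0) +
            ∑ w, (if G.Adj u w then g u - g w else 0) := by
          rw [← Finset.sum_add_distrib]
          refine Finset.sum_congr rfl fun w _ => ?_
          split_ifs <;> ring
        rw [this]; ring
      map_smul' := by
        intro c f
        ext u
        simp only [Pi.smul_apply, smul_eq_mul, edgeFlow, RingHom.id_apply, mul_add, Finset.mul_sum]
        congr 1
        refine Finset.sum_congr rfl fun w _ => ?_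
        split_ifs <;> ring }
  have hT : ∀ f u, T f u = ∑ w, edgeFlow G f u w + ∑ w, f w := fun f u => rfl
  have hsumT : ∀ f, ∑ u, T f u = Fintype.card V * ∑ w, f w := by
    intro f
    simp only [hT, Finset.sum_add_distrib, sum_edgeFlow_self, zero_add, Finset.sum_const,
      Finset.card_univ, nsmul_eq_mul]
  have hinj : Function.Injective T := by
    rw [← LinearMap.ker_eq_bot, LinearMap.ker_eq_bot']
    intro f hf
    have h0 : ∑ w, f w = 0 := by
      have h := hsumT f
      rw [hf] at h
      simpa [hcard] using h.symm
    have h1 : ∀ u, ∑ w, edgeFlow G f u w = 0 := by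
      intro u
      have h := hT f u
      rw [hf, h0] at h
      simpa using h.symm
    have h2 : ∑ u, ∑ w, edgeFlow G f u w ^ 2 = 0 := by
      have h := sum_edgeFlow_sq G f
      simp only [h1, mul_zero, Finset.sum_const_zero] at h
      linarith
    have h3 : ∀ u w, G.Adj u w → f u = f w := by
      intro u w hadj
      have h4 := (Finset.sum_eq_zero_iff_of_nonneg fun u _ =>
        Finset.sum_nonneg fun w _ => sq_nonneg (edgeFlow G f u w)).1 h2 u (Finset.mem_univ u)
      have h5 := (Finset.sum_eq_zero_iff_of_nonneg fun w _ =>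
        sq_nonneg (edgeFlow G f u w)).1 h4 w (Finset.mem_univ w)
      simp only [edgeFlow, hadj, if_true] at h5
      have := pow_eq_zero_iff (two_ne_zero) |>.1 h5
      linarith
    have h6 : ∀ u w, f u = f w := by
      intro u w
      obtain ⟨p⟩ := hG.preconnected u w
      induction p with
      | nil => rfl
      | cons h _ ih => exact (h3 _ _ h).trans ih
    ext u
    have : ∑ w, f w = Fintype.card V * f u := by
      rw [Finset.sum_congr rfl fun w _ => h6 w u]
      simp
    rw [h0] at this
    simpa [hcard] using this.symm
  obtain ⟨f, hf⟩ := LinearMap.injective_iff_surjective.1 hinj b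
  refine ⟨f, fun u => ?_⟩
  have h0 : ∑ w, f w = 0 := by
    have h := hsumT f
    rw [hf, hb] at h
    simpa [hcard] using h.symm
  have h := hT f u
  rw [hf, h0] at h
  linarith

/-- The current that leaves an upper level set is at least the potential drop times the number of
edges along which it occurs. -/
theorem mul_edgeCount_le_sum_edgeFlow [Fintype V] (f : V → ℝ) {A C : Finset V}
    (hA : ∀ u ∈ A, ∀ w ∉ A, f w ≤ f u) (hAC : Disjoint A C) {s : ℝ}
    (hs : ∀ u ∈ A, ∀ w ∈ C, s ≤ f u - f w) :
    s * edgeCount G A C ≤ ∑ u ∈ A, ∑ w, edgeFlow G f u w := by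
  classical
  have h1 : ∑ u ∈ A, ∑ w, edgeFlow G f u w = ∑ u ∈ A, ∑ w ∈ Aᶜ, edgeFlow G f u w := by
    simp_rw [← Finset.sum_add_sum_compl A, Finset.sum_add_distrib, sum_edgeFlow_self, zero_add]
  have h2 : s * edgeCount G A C = ∑ u ∈ A, ∑ w ∈ C, if G.Adj u w then s else 0 := by
    rw [← Finset.sum_product', ← Finset.sum_filter, Finset.sum_const, nsmul_eq_mul, mul_comm]
    rfl
  rw [h1, h2]
  refine Finset.sum_le_sum fun u hu => ?_
  have hsub : C ⊆ Aᶜ := fun w hw => Finset.mem_compl.2 fun h => Finset.disjoint_left.1 hAC h hw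
  refine le_trans (Finset.sum_le_sum fun w hw => ?_)
    (Finset.sum_le_sum_of_subset_of_nonneg hsub fun w hw _ => ?_)
  · unfold edgeFlow
    split_ifs
    · exact hs u hu w hw
    · exact le_rfl
  · unfold edgeFlow
    split_ifs
    · linarith [hA u hu w (Finset.mem_compl.1 hw)]
    · exact le_rfl

/-- The values of a function on a finite type in decreasing order. -/
theorem exists_antitone_enum [Fintype V] [Nonempty V] (f : V → ℝ) :
    ∃ e : ℕ → V, Antitone (f ∘ e) ∧ Set.InjOn e (Set.Iio (Fintype.card V)) ∧
      ∀ u, ∃ i < Fintype.card V, e i = u := by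
  classical
  set m := Fintype.card V with hm
  have hm0 : 0 < m := Fintype.card_pos
  let e₀ := (Fintype.equivFin V).symm
  let σ := Tuple.sort (fun i => - f (e₀ i))
  have hσ : Monotone ((fun i => - f (e₀ i)) ∘ σ) := Tuple.monotone_sort _
  -- Beyond the last rank the enumeration repeats its final vertex, so it stays antitone on all of
  -- `ℕ`.
  refine ⟨fun i => e₀ (σ ⟨min i (m - 1), by omega⟩), ?_, ?_, ?_⟩
  · intro i j hij
    have := hσ (show (⟨min i (m - 1), by omega⟩ : Fin m) ≤ ⟨min j (m - 1), by omega⟩ by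
      simp only [Fin.mk_le_mk]; omega)
    simp only [Function.comp_apply] at this ⊢
    linarith
  · intro i hi j hj hij
    simp only [EmbeddingLike.apply_eq_iff_eq, Fin.mk.injEq] at hij
    simp only [Set.mem_Iio] at hi hj
    omega
  · intro u
    refine ⟨(σ.symm (e₀.symm u) : Fin m), (σ.symm (e₀.symm u)).2, ?_⟩
    have : (⟨min ((σ.symm (e₀.symm u) : Fin m) : ℕ) (m - 1), by omega⟩ : Fin m) =
        σ.symm (e₀.symm u) := by
      ext
      have := (σ.symm (e₀.symm u)).2
      simp only
      omega
    simp only [this, Equiv.apply_symm_apply]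

/-- The drop of the potential between two ranks, if `e` lists the vertices by decreasing
potential. -/
theorem rank_drop_mul_edgeCount_le [Fintype V] [DecidableEq V] (f : V → ℝ) (e : ℕ → V)
    (hanti : Antitone (f ∘ e)) (hinj : Set.InjOn e (Set.Iio (Fintype.card V)))
    (hsurj : ∀ u, ∃ i < Fintype.card V, e i = u) {a b : ℕ} (hab : a < b)
    (hbm : b ≤ Fintype.card V) :
    ∃ A C : Finset V, A.card = a + 1 ∧ C.card = Fintype.card V - b ∧ Disjoint A C ∧
      (f (e a) - f (e b)) * edgeCount G A C ≤ ∑ u ∈ A, ∑ w, edgeFlow G f u w := by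
  have hA : Set.InjOn e (Finset.range (a + 1)) := hinj.mono fun i hi => by
    simp only [Finset.coe_range, Set.mem_Iio] at hi ⊢; omega
  have hC : Set.InjOn e (Finset.Ico b (Fintype.card V)) := hinj.mono fun i hi => by
    simp only [Finset.coe_Ico, Set.mem_Ico, Set.mem_Iio] at hi ⊢; omega
  have hdisj : Disjoint ((Finset.range (a + 1)).image e)
      ((Finset.Ico b (Fintype.card V)).image e) := by
    rw [Finset.disjoint_left]
    intro u hu hu'
    obtain ⟨i, hi, rfl⟩ := Finset.mem_image.1 hu
    obtain ⟨j, hj, hij⟩ := Finset.mem_image.1 hu'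
    rw [Finset.mem_range] at hi
    rw [Finset.mem_Ico] at hj
    have := hinj (show j ∈ Set.Iio _ from hj.2) (show i ∈ Set.Iio _ by
      rw [Set.mem_Iio]; omega) hij
    omega
  -- `A` consists of the ranks up to `a` and `C` of the ranks from `b` on. Every edge between them
  -- carries at least the drop from rank `a` to rank `b`.
  refine ⟨(Finset.range (a + 1)).image e, (Finset.Ico b (Fintype.card V)).image e, ?_, ?_, hdisj,
    mul_edgeCount_le_sum_edgeFlow G f ?_ hdisj ?_⟩
  · rw [Finset.card_image_of_injOn hA, Finset.card_range]
  · rw [Finset.card_image_of_injOn hC, Nat.card_Ico]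
  · intro u hu w hw
    obtain ⟨i, hi, rfl⟩ := Finset.mem_image.1 hu
    obtain ⟨j, hj, rfl⟩ := hsurj w
    refine hanti ?_
    by_contra hcon
    push Not at hcon
    rw [Finset.mem_range] at hi
    exact hw (Finset.mem_image_of_mem e (Finset.mem_range.2 (by omega)))
  · intro u hu w hw
    obtain ⟨i, hi, rfl⟩ := Finset.mem_image.1 hu
    obtain ⟨j, hj, rfl⟩ := Finset.mem_image.1 hw
    rw [Finset.mem_range] at hi
    rw [Finset.mem_Ico] at hj
    have h1 : f (e a) ≤ f (e i) := hanti (by omega)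
    have h2 : f (e j) ≤ f (e b) := hanti hj.1
    linarith

theorem edgeCount_pos_of_connected [Fintype V] [DecidableEq V] (hG : G.Connected)
    {A C : Finset V} (hA : A.Nonempty) (hC : C.Nonempty) (hAC : Disjoint A C)
    (hcard : A.card + C.card = Fintype.card V) : 0 < edgeCount G A C := by
  classical
  have hCeq : C = Aᶜ := by
    refine Finset.eq_of_subset_of_card_le
      (fun w hw => Finset.mem_compl.2 fun h => Finset.disjoint_left.1 hAC h hw) ?_
    rw [Finset.card_compl]; omega
  obtain ⟨u, hu⟩ := hA
  obtain ⟨w, hw⟩ := hC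
  obtain ⟨p⟩ := hG.preconnected u w
  obtain ⟨d, -, hd1, hd2⟩ := p.exists_boundary_dart (A : Set V) hu
    (fun h => Finset.disjoint_left.1 hAC h hw)
  refine Finset.card_pos.2 ⟨(d.fst, d.snd), ?_⟩
  simp only [Finset.mem_filter, Finset.mem_product]
  exact ⟨⟨hd1, by rw [hCeq, Finset.mem_compl]; exact hd2⟩, d.adj⟩

end Potential

/-! ### Energy of the unit current on complete, connected and expanding graphs. -/

section Energy

variable {V : Type*} [Fintype V] [DecidableEq V] (G : SimpleGraph V)

theorem sum_div_eq {f : V → ℝ} {v : V}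
    (hf : ∀ u, ∑ w, edgeFlow G f u w = (if u = v then 1 else 0) - 1 / (Fintype.card V : ℝ))
    (A : Finset V) : ∑ u ∈ A, ∑ w, edgeFlow G f u w =
      (if v ∈ A then 1 else 0) - (A.card : ℝ) / Fintype.card V := by
  simp only [hf, Finset.sum_sub_distrib, Finset.sum_ite_eq', Finset.sum_const, nsmul_eq_mul]
  ring

/-- The energy of the current is a difference of potentials. -/
theorem energy_eq {f : V → ℝ} {v : V}
    (hf : ∀ u, ∑ w, edgeFlow G f u w = (if u = v then 1 else 0) - 1 / (Fintype.card V : ℝ)) :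
    (∑ u, ∑ w, edgeFlow G f u w ^ 2) / 2 = f v - (∑ u, f u) / Fintype.card V := by
  rw [sum_edgeFlow_sq]
  simp only [hf, mul_sub, Finset.sum_sub_distrib, mul_ite, mul_one, mul_zero, Finset.sum_ite_eq',
    Finset.mem_univ, if_true]
  rw [← Finset.sum_mul]
  ring

/-- The potential `1/m` at `v` and `0` elsewhere already drives the required current. -/
theorem energy_le_of_complete [Nonempty V] (hG : G = ⊤) (v : V) :
    ∃ f : V → ℝ, (∀ u, ∑ w, edgeFlow G f u w =
      (if u = v then 1 else 0) - 1 / (Fintype.card V : ℝ)) ∧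
      (∑ u, ∑ w, edgeFlow G f u w ^ 2) / 2 ≤ 1 / Fintype.card V := by
  have hm : (0 : ℝ) < Fintype.card V := by exact_mod_cast Fintype.card_pos
  have hf : ∀ u, ∑ w, edgeFlow G (fun u => if u = v then 1 / (Fintype.card V : ℝ) else 0) u w =
      (if u = v then 1 else 0) - 1 / (Fintype.card V : ℝ) := by
    intro u
    have h1 : ∀ w, edgeFlow G (fun u => if u = v then 1 / (Fintype.card V : ℝ) else 0) u w =
        (if u = v then 1 / (Fintype.card V : ℝ) else 0) -
          (if w = v then 1 / (Fintype.card V : ℝ) else 0) := by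
      intro w
      subst hG
      by_cases h : u = w
      · subst h; simp [edgeFlow]
      · simp [edgeFlow, h]
    simp only [h1, Finset.sum_sub_distrib, Finset.sum_const, Finset.card_univ, nsmul_eq_mul,
      Finset.sum_ite_eq', Finset.mem_univ, if_true]
    split_ifs
    · field_simp
    · simp
  refine ⟨_, hf, ?_⟩
  rw [energy_eq G hf]
  simp only [Finset.sum_ite_eq', Finset.mem_univ, if_true]
  have : 0 ≤ 1 / (Fintype.card V : ℝ) / Fintype.card V := by positivity
  linarith

theorem energy_le_of_connected (hG : G.Connected) (v : V) :
    ∃ f : V → ℝ, (∀ u, ∑ w, edgeFlow G f u w =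
      (if u = v then 1 else 0) - 1 / (Fintype.card V : ℝ)) ∧
      (∑ u, ∑ w, edgeFlow G f u w ^ 2) / 2 ≤ Fintype.card V / 3 := by
  have hne := hG.nonempty
  have hm : (0 : ℝ) < Fintype.card V := by exact_mod_cast Fintype.card_pos
  obtain ⟨f, hf⟩ := exists_potential G hG
    (fun u => (if u = v then 1 else 0) - 1 / (Fintype.card V : ℝ)) (by
      simp only [Finset.sum_sub_distrib, Finset.sum_ite_eq', Finset.mem_univ, if_true,
        Finset.sum_const, Finset.card_univ, nsmul_eq_mul]
      field_simp
      ring)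
  refine ⟨f, hf, ?_⟩
  rw [energy_eq G hf]
  obtain ⟨e, hanti, hinj, hsurj⟩ := exists_antitone_enum f
  set m := Fintype.card V with hmdef
  -- The net current out of the top `i + 1` vertices is at most the right-hand side, and
  -- connectedness gives at least one edge across.
  have hdrop : ∀ i, i + 1 < m → f (e i) - f (e (i + 1)) ≤ 1 - ((i : ℝ) + 1) / m := by
    intro i hi
    obtain ⟨A, C, hAc, hCc, hAC, hle⟩ :=
      rank_drop_mul_edgeCount_le G f e hanti hinj hsurj (Nat.lt_succ_self i) hi.le
    rw [sum_div_eq G hf, hAc] at hle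
    have hpos : 0 < edgeCount G A C := edgeCount_pos_of_connected G hG
      (Finset.card_pos.1 (by omega)) (Finset.card_pos.1 (by omega)) hAC (by omega)
    have h1 : (1 : ℝ) ≤ edgeCount G A C := by exact_mod_cast hpos
    have h0 : 0 ≤ f (e i) - f (e (i + 1)) := sub_nonneg.2 (hanti (Nat.le_succ i))
    have h2 : (if v ∈ A then (1 : ℝ) else 0) ≤ 1 := by split_ifs <;> norm_num
    push_cast at hle
    have h3 : f (e i) - f (e (i + 1)) ≤ (f (e i) - f (e (i + 1))) * edgeCount G A C :=
      le_mul_of_one_le_right h0 h1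
    simp only [Nat.succ_eq_add_one, hmdef] at *
    linarith
  have hcum : ∀ k, k < m → f (e 0) - f (e k) ≤ k - (k : ℝ) * (k + 1) / (2 * m) := by
    intro k
    induction k with
    | zero => intro _; simp
    | succ k ih =>
      intro hk
      have h1 := ih (by omega)
      have h2 := hdrop k hk
      have h3 : (k : ℝ) - k * (k + 1) / (2 * m) + (1 - (k + 1) / m) =
          ((k + 1 : ℕ) : ℝ) - ((k + 1 : ℕ) : ℝ) * (((k + 1 : ℕ) : ℝ) + 1) / (2 * m) := by
        push_cast; field_simp; ring
      linarith
  have hsum : ∑ u, f u = ∑ k ∈ Finset.range m, f (e k) := by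
    have : (Finset.univ : Finset V) = (Finset.range m).image e := by
      ext u
      obtain ⟨i, hi, rfl⟩ := hsurj u
      simp only [Finset.mem_univ, true_iff]
      exact Finset.mem_image_of_mem e (Finset.mem_range.2 hi)
    rw [this, Finset.sum_image (by simpa using hinj)]
  have hpoly : ∀ j : ℕ, ∑ k ∈ Finset.range j, ((k : ℝ) - (k : ℝ) * (k + 1) / (2 * m)) =
      (j : ℝ) * (j - 1) / 2 - ((j : ℝ) - 1) * j * (j + 1) / (6 * m) := by
    intro j
    induction j with
    | zero => simp
    | succ j ih => rw [Finset.sum_range_succ, ih]; push_cast; field_simp; ring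
  have hv : f v ≤ f (e 0) := by
    obtain ⟨i, hi, rfl⟩ := hsurj v
    exact hanti (Nat.zero_le i)
  have htot : m * f (e 0) - ∑ u, f u ≤
      (m : ℝ) * (m - 1) / 2 - ((m : ℝ) - 1) * m * (m + 1) / (6 * m) := by
    rw [hsum, ← hpoly]
    have : (m : ℝ) * f (e 0) = ∑ k ∈ Finset.range m, f (e 0) := by simp
    rw [this, ← Finset.sum_sub_distrib]
    exact Finset.sum_le_sum fun k hk => hcum k (Finset.mem_range.1 hk)
  have h1 : f v - (∑ u, f u) / m ≤ (m * f (e 0) - ∑ u, f u) / m := by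
    rw [sub_div, mul_div_cancel_left₀ _ hm.ne']
    linarith
  refine h1.trans ?_
  rw [div_le_iff₀ hm]
  -- The total becomes `(m - 1)(2m - 1) / 6 ≤ m²/3`; this is the value for a path with `v` at an
  -- end.
  have h2 : ((m : ℝ) - 1) * m * (m + 1) / (6 * m) = (m ^ 2 - 1) / 6 := by field_simp; ring
  rw [h2] at htot
  have : (1 : ℝ) ≤ m := by exact_mod_cast Fintype.card_pos
  nlinarith

/-- Every small vertex set has at least its share, up to the factor `τ`, of edges to each
sufficiently large set. -/
def IsExpanding (τ : ℝ) : Prop :=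
  ∀ A C : Finset V, Disjoint A C → 1 ≤ A.card → A.card ≤ Fintype.card V / 2 →
    C.card = Fintype.card V - min (2 * A.card - 1) (Fintype.card V / 2) →
    τ * A.card * C.card / Fintype.card V ≤ edgeCount G A C

/-- A reachability class or its complement has at most half of the vertices, and expansion provides
an edge leaving it. -/
theorem IsExpanding.connected [Nonempty V] {G : SimpleGraph V} {τ : ℝ} (hG : IsExpanding G τ)
    (hτ : 0 < τ) : G.Connected := by
  classical
  have hm : 0 < Fintype.card V := Fintype.card_pos
  have key : ∀ S : Finset V, S.Nonempty → S.card ≤ Fintype.card V / 2 →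
      ∃ u ∈ S, ∃ w ∉ S, G.Adj u w := by
    intro S hS hcard
    obtain ⟨C, hC, hCc⟩ := Finset.exists_subset_card_eq
      (show Fintype.card V - min (2 * S.card - 1) (Fintype.card V / 2) ≤ Sᶜ.card by
        rw [Finset.card_compl]
        have := Finset.card_pos.2 hS
        omega)
    have hd : Disjoint S C := Finset.disjoint_left.2 fun u hu hu' => Finset.mem_compl.1 (hC hu') hu
    have h1 := hG S C hd (Finset.card_pos.2 hS) hcard hCc
    have h2 : 0 < edgeCount G S C := by
      have hSp : 0 < S.card := Finset.card_pos.2 hS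
      have hCp : 0 < C.card := by omega
      have : 0 < τ * S.card * C.card / Fintype.card V := by positivity
      exact_mod_cast this.trans_le h1
    obtain ⟨p, hp⟩ := Finset.card_pos.1 h2
    simp only [Finset.mem_filter, Finset.mem_product] at hp
    exact ⟨p.1, hp.1.1, p.2, Finset.mem_compl.1 (hC hp.1.2), hp.2⟩
  refine ⟨fun u w => ?_⟩
  by_contra hcon
  set S : Finset V := Finset.univ.filter fun x => G.Reachable u x with hS
  have hout : ∀ x ∈ S, ∀ y ∉ S, ¬ G.Adj x y := by
    intro x hx y hy hxy
    simp only [hS, Finset.mem_filter, Finset.mem_univ, true_and] at hx hy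
    exact hy (hx.trans hxy.reachable)
  have hu : u ∈ S := by simp [hS]
  have hw : w ∈ Sᶜ := by simp [hS, hcon]
  rcases le_or_gt S.card (Fintype.card V / 2) with h | h
  · obtain ⟨x, hx, y, hy, hxy⟩ := key S ⟨u, hu⟩ h
    exact hout x hx y hy hxy
  · obtain ⟨x, hx, y, hy, hxy⟩ := key Sᶜ ⟨w, hw⟩ (by rw [Finset.card_compl]; omega)
    refine hout y ?_ x ?_ hxy.symm
    · simpa using hy
    · simpa using hx

/-- Climbing from the median to the top by doubling the level sets. -/
theorem exists_median_bound [Nonempty V] {τ : ℝ} (hG : IsExpanding G τ) (f : V → ℝ) (Φ : ℕ → ℝ)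
    (hΦ : ∀ A : Finset V, ∑ u ∈ A, ∑ w, edgeFlow G f u w ≤ Φ A.card) (Ψ : ℕ → ℝ) (h0 : 0 ≤ Ψ 0)
    (hpos : ∀ a c : ℕ, 1 ≤ a → 1 ≤ c → 0 < τ * a * c / Fintype.card V)
    (hmono : Monotone Ψ)
    (hΨ : ∀ j c : ℕ, 2 ^ j ≤ Fintype.card V / 2 →
      c = Fintype.card V - min (2 * 2 ^ j - 1) (Fintype.card V / 2) →
      Φ (2 ^ j) ≤ (Ψ (j + 1) - Ψ j) * (τ * (2 ^ j : ℕ) * c / Fintype.card V)) :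
    ∃ t, (∀ u, f u ≤ t + Ψ (Nat.log 2 (Fintype.card V))) ∧
      Fintype.card V / 2 < (Finset.univ.filter fun u => t ≤ f u).card := by
  obtain ⟨e, hanti, hinj, hsurj⟩ := exists_antitone_enum f
  set m := Fintype.card V with hmdef
  have hm0 : 0 < m := Fintype.card_pos
  -- Ranks start at `0`, so the top `2^j` vertices end at rank `2^j - 1`. The next rank is `2 * 2^j
  -- - 1`, capped at the median `m / 2`, which explains the size of `C` in `IsExpanding`.
  have hcum : ∀ j, f (e 0) ≤ f (e (min (2 ^ j - 1) (m / 2))) + Ψ j := by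
    intro j
    induction j with
    | zero => simpa using h0
    | succ j ih =>
      have hp : 1 ≤ 2 ^ j := Nat.one_le_two_pow
      have hp2 : 2 ^ (j + 1) = 2 * 2 ^ j := by ring
      rcases Nat.lt_or_ge (2 ^ j) (m / 2 + 1) with hj | hj
      · have h1 : min (2 ^ j - 1) (m / 2) = 2 ^ j - 1 := by omega
        rw [h1] at ih
        rcases Nat.lt_or_ge (2 ^ j - 1) (min (2 ^ (j + 1) - 1) (m / 2)) with hlt | hge
        · obtain ⟨A, C, hAc, hCc, hAC, hle⟩ := rank_drop_mul_edgeCount_le G f e hanti hinj hsurj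
            hlt (by omega)
          have hAc' : A.card = 2 ^ j := by omega
          have h2 := hG A C hAC (by omega) (by omega) (by rw [hCc, hAc', hp2])
          have h3 := hΦ A
          rw [hAc'] at h3 h2
          have h4 := hΨ j C.card (by omega) (by rw [hCc, hp2])
          have h5 := hpos (2 ^ j) C.card hp (by omega)
          have h6 : 0 ≤ f (e (2 ^ j - 1)) - f (e (min (2 ^ (j + 1) - 1) (m / 2))) :=
            sub_nonneg.2 (hanti hlt.le)
          have h7 := (mul_le_mul_of_nonneg_left h2 h6).trans (hle.trans (h3.trans h4))
          have h8 := le_of_mul_le_mul_right h7 h5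
          linarith
        · have h2 : min (2 ^ (j + 1) - 1) (m / 2) = 2 ^ j - 1 := by omega
          rw [h2]
          exact ih.trans (by linarith [hmono (Nat.le_succ j)])
      · have h1 : min (2 ^ j - 1) (m / 2) = m / 2 := by omega
        have h2 : min (2 ^ (j + 1) - 1) (m / 2) = m / 2 := by omega
        rw [h1] at ih
        rw [h2]
        exact ih.trans (by linarith [hmono (Nat.le_succ j)])
  have hlog : m < 2 ^ (Nat.log 2 m + 1) := Nat.lt_pow_succ_log_self (by norm_num) m
  have hmed : min (2 ^ Nat.log 2 m - 1) (m / 2) = m / 2 := by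
    rw [pow_succ] at hlog; omega
  refine ⟨f (e (m / 2)), fun u => ?_, ?_⟩
  · have h1 := hcum (Nat.log 2 m)
    rw [hmed] at h1
    obtain ⟨i, hi, rfl⟩ := hsurj u
    exact (hanti (Nat.zero_le i)).trans h1
  · have h1 : (Finset.range (m / 2 + 1)).image e ⊆ Finset.univ.filter fun u => f (e (m / 2)) ≤ f u := by
      intro u hu
      obtain ⟨i, hi, rfl⟩ := Finset.mem_image.1 hu
      simp only [Finset.mem_filter, Finset.mem_univ, true_and]
      exact hanti (by rw [Finset.mem_range] at hi; omega)
    have h2 := Finset.card_le_card h1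
    rw [Finset.card_image_of_injOn (hinj.mono fun i hi => by
      simp only [Finset.coe_range, Set.mem_Iio] at hi ⊢; omega), Finset.card_range] at h2
    omega

/-- The potential at `v` exceeds every other value by at most the climb from the median of `f` plus
the climb from the median of `-f`, and the energy is the average of these differences. -/
theorem energy_le_of_isExpanding [Nonempty V] {τ : ℝ} (hτ : 0 < τ) (hG : IsExpanding G τ) (v : V) :
    ∃ f : V → ℝ, (∀ u, ∑ w, edgeFlow G f u w =
      (if u = v then 1 else 0) - 1 / (Fintype.card V : ℝ)) ∧
      (∑ u, ∑ w, edgeFlow G f u w ^ 2) / 2 ≤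
        2 / τ + 6 * Nat.log 2 (Fintype.card V) / (τ * Fintype.card V) := by
  have hm : (0 : ℝ) < Fintype.card V := by exact_mod_cast Fintype.card_pos
  obtain ⟨f, hf⟩ := exists_potential G (hG.connected hτ)
    (fun u => (if u = v then 1 else 0) - 1 / (Fintype.card V : ℝ)) (by
      simp only [Finset.sum_sub_distrib, Finset.sum_ite_eq', Finset.mem_univ, if_true,
        Finset.sum_const, Finset.card_univ, nsmul_eq_mul]
      field_simp
      ring)
  refine ⟨f, hf, ?_⟩
  rw [energy_eq G hf]
  have hsum := sum_div_eq G hf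
  set m := Fintype.card V with hmdef
  have hpos : ∀ a c : ℕ, 1 ≤ a → 1 ≤ c → 0 < τ * a * c / m := by
    intro a c ha hc
    have : (0 : ℝ) < a := by exact_mod_cast ha
    have : (0 : ℝ) < c := by exact_mod_cast hc
    positivity
  have hcbounds : ∀ j c : ℕ, 2 ^ j ≤ m / 2 → c = m - min (2 * 2 ^ j - 1) (m / 2) →
      (m : ℝ) ≤ 2 * c ∧ (m : ℝ) - 2 * (2 ^ j : ℕ) ≤ c ∧ (c : ℝ) ≤ m := by
    intro j c hj hc
    refine ⟨by exact_mod_cast (by omega : m ≤ 2 * c), ?_, by exact_mod_cast (by omega : c ≤ m)⟩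
    have : m ≤ c + 2 * 2 ^ j := by omega
    rw [sub_le_iff_le_add]
    exact_mod_cast this
  obtain ⟨t, ht, htc⟩ := exists_median_bound G hG f (fun _ => 1) (fun A => by
      rw [hsum]
      have : 0 ≤ (A.card : ℝ) / m := by positivity
      split_ifs <;> linarith)
    -- With `a = 2^j` and unit current the drop is at most `m / (τ a c)`. Since `c ≥ m - 2a` and `c
    -- ≥ m/2`, one has `m/c ≤ 1 + 4a/m`, so the increments are `1/(τ a) + 4/(τ m)`.
    (fun j => (2 - 2 / 2 ^ j) / τ + 4 * j / (τ * m)) (by simp) hpos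
    (monotone_nat_of_le_succ fun j => by
      push_cast
      gcongr
      · norm_num
      · omega
      · linarith)
    (fun j c hj hc => by
      obtain ⟨h1, h2, h3⟩ := hcbounds j c hj hc
      push_cast at h2 ⊢
      have hp : (0 : ℝ) < 2 ^ j := by positivity
      set a : ℝ := 2 ^ j
      have e1 : ((2 - 2 / 2 ^ (j + 1)) / τ + 4 * ((j : ℝ) + 1) / (τ * m) -
          ((2 - 2 / a) / τ + 4 * j / (τ * m))) * (τ * a * c / m) =
          (1 + 4 * a / m) * (c / m) := by
        rw [pow_succ]
        change ((2 - 2 / (a * 2)) / τ + _ - _) * _ = _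
        field_simp
        ring
      rw [e1, show (1 + 4 * a / m) * (c / m) = ((m + 4 * a) * c) / m ^ 2 by field_simp,
        le_div_iff₀ (by positivity)]
      nlinarith)
  obtain ⟨t', ht', htc'⟩ := exists_median_bound G hG (-f) (fun a => (a : ℝ) / m) (fun A => by
      simp only [edgeFlow_neg, Finset.sum_neg_distrib]
      rw [hsum]
      split_ifs <;> linarith)
    -- From below, a set of `a` vertices absorbs at most `a/m`, so the drop is at most `1/(τ c) ≤
    -- 2/(τ m)`.
    (fun j => 2 * j / (τ * m)) (by simp) hpos
    (monotone_nat_of_le_succ fun j => by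
      push_cast
      gcongr
      linarith)
    (fun j c hj hc => by
      obtain ⟨h1, h2, h3⟩ := hcbounds j c hj hc
      push_cast at h2 ⊢
      have hp : (0 : ℝ) < 2 ^ j := by positivity
      set a : ℝ := 2 ^ j
      have e1 : (2 * ((j : ℝ) + 1) / (τ * m) - 2 * j / (τ * m)) * (τ * a * c / m) =
          a * (2 * c) / m ^ 2 := by
        field_simp
        ring
      rw [e1, div_le_div_iff₀ hm (by positivity)]
      nlinarith [mul_le_mul_of_nonneg_left h1 (mul_pos hp hm).le])
  -- Two sets of more than half of the vertices meet, which gives `t + t' ≤ 0` and joins the two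
  -- climbs.
  obtain ⟨u, hu⟩ : ((Finset.univ.filter fun u => t ≤ f u) ∩
      (Finset.univ.filter fun u => t' ≤ (-f) u)).Nonempty := by
    rw [← Finset.card_pos]
    have h1 := Finset.card_union_add_card_inter (Finset.univ.filter fun u => t ≤ f u)
      (Finset.univ.filter fun u => t' ≤ (-f) u)
    have h2 := Finset.card_le_univ ((Finset.univ.filter fun u => t ≤ f u) ∪
      (Finset.univ.filter fun u => t' ≤ (-f) u))
    omega
  simp only [Finset.mem_inter, Finset.mem_filter, Finset.mem_univ, true_and, Pi.neg_apply] at hu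
  have hdiff : ∀ w, f v - f w ≤ 2 / τ + 6 * Nat.log 2 m / (τ * m) := by
    intro w
    have h1 := ht v
    have h2 := ht' w
    simp only [Pi.neg_apply] at h2
    have h3 : (2 - 2 / 2 ^ Nat.log 2 m) / τ ≤ 2 / τ := by
      gcongr
      have : (0 : ℝ) < 2 / 2 ^ Nat.log 2 m := by positivity
      linarith
    have h4 : 6 * (Nat.log 2 m : ℝ) / (τ * m) =
        4 * Nat.log 2 m / (τ * m) + 2 * Nat.log 2 m / (τ * m) := by ring
    linarith [hu.1, hu.2]
  have h1 : f v - (∑ u, f u) / m = (∑ w, (f v - f w)) / m := by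
    rw [Finset.sum_sub_distrib, Finset.sum_const, Finset.card_univ, nsmul_eq_mul, sub_div,
      mul_div_cancel_left₀ _ hm.ne']
  rw [h1, div_le_iff₀ hm]
  calc _ ≤ ∑ w : V, (2 / τ + 6 * Nat.log 2 m / (τ * m)) := Finset.sum_le_sum fun w _ => hdiff w
    _ = _ := by rw [Finset.sum_const, Finset.card_univ, nsmul_eq_mul, mul_comm]

end Energy

/-! ### Negative correlation of uniform subsets of fixed size. -/

section NegativeCorrelation

variable {α : Type*} [DecidableEq α]

theorem sum_powersetCard_succ_insert (y : α → ℝ) {x : α} {s : Finset α} (hx : x ∉ s) (k : ℕ) :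
    ∑ T ∈ (insert x s).powersetCard (k + 1), ∏ i ∈ T, y i =
      ∑ T ∈ s.powersetCard (k + 1), ∏ i ∈ T, y i + y x * ∑ T ∈ s.powersetCard k, ∏ i ∈ T, y i := by
  have hmem : ∀ T ∈ s.powersetCard k, x ∉ T := fun T hT h => hx ((Finset.mem_powersetCard.1 hT).1 h)
  rw [Finset.powersetCard_succ_insert hx, Finset.sum_union, Finset.sum_image, Finset.mul_sum]
  · congr 1
    exact Finset.sum_congr rfl fun T hT => Finset.prod_insert (hmem T hT)
  · intro T hT T' hT' h
    rw [← Finset.erase_insert (hmem T hT), ← Finset.erase_insert (hmem T' hT'), h]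
  · rw [Finset.disjoint_left]
    intro T hT hT'
    obtain ⟨T', -, rfl⟩ := Finset.mem_image.1 hT'
    exact hx ((Finset.mem_powersetCard.1 hT).1 (Finset.mem_insert_self x T'))

/-- Every `(k+1)`-subset arises in `k + 1` ways by adding one of `s.card - k` elements to a
`k`-subset, and the added factor is at most 1. -/
theorem succ_mul_sum_powersetCard_succ_le (y : α → ℝ) (h0 : ∀ i, 0 ≤ y i) (h1 : ∀ i, y i ≤ 1)
    (s : Finset α) : ∀ k : ℕ, ((k : ℝ) + 1) * ∑ T ∈ s.powersetCard (k + 1), ∏ i ∈ T, y i ≤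
      ((s.card : ℝ) - k) * ∑ T ∈ s.powersetCard k, ∏ i ∈ T, y i := by
  have hnn : ∀ (s : Finset α) k, 0 ≤ ∑ T ∈ s.powersetCard k, ∏ i ∈ T, y i := fun s k =>
    Finset.sum_nonneg fun T _ => Finset.prod_nonneg fun i _ => h0 i
  induction s using Finset.induction_on with
  | empty =>
    intro k
    have h : ∀ j, (∅ : Finset α).powersetCard (j + 1) = ∅ := fun j =>
      Finset.powersetCard_eq_empty.2 (by simp)
    cases k with
    | zero => simp [h]
    | succ k => simp [h]
  | insert x s hx ih =>
    intro k
    rw [Finset.card_insert_of_notMem hx, sum_powersetCard_succ_insert y hx]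
    cases k with
    | zero =>
      have h := ih 0
      simp only [Nat.cast_zero, zero_add, one_mul, sub_zero, Finset.powersetCard_zero,
        Finset.sum_singleton, Finset.prod_empty, mul_one, Nat.cast_add, Nat.cast_one] at h ⊢
      linarith [h1 x]
    | succ k =>
      rw [sum_powersetCard_succ_insert y hx]
      have h2 := ih (k + 1)
      have h3 := mul_le_mul_of_nonneg_left (ih k) (h0 x)
      have h4 := mul_le_mul_of_nonneg_right (h1 x) (hnn s (k + 1))
      push_cast at h2 h3 ⊢
      linarith

/-- A uniform `k`-subset is negatively correlated: the generating function of the size of its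
intersection with a fixed set is at most that of independent draws. -/
theorem sum_powersetCard_prod_le {z : ℝ} (hz0 : 0 ≤ z) (hz1 : z ≤ 1) (U : Finset α) (k : ℕ)
    (W : Finset α) (hW : W ⊆ U) :
    ∑ T ∈ U.powersetCard k, ∏ i ∈ W, (if i ∈ T then z else 1) ≤
      U.card.choose k * (1 - (k : ℝ) / U.card * (1 - z)) ^ W.card := by
  rcases lt_or_ge U.card k with hk | hk
  · rw [Finset.powersetCard_eq_empty.2 hk, Nat.choose_eq_zero_of_lt hk]
    simp
  have hp1 : (k : ℝ) / U.card ≤ 1 := div_le_one_of_le₀ (by exact_mod_cast hk) (by positivity)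
  have hb : 0 ≤ 1 - (k : ℝ) / U.card * (1 - z) := by
    have : 0 ≤ (k : ℝ) / U.card := by positivity
    nlinarith
  -- Both products equal `z` to the power `(T ∩ W).card`; the second is an elementary symmetric
  -- polynomial.
  have hconv : ∀ W : Finset α, W ⊆ U →
      ∑ T ∈ U.powersetCard k, ∏ i ∈ W, (if i ∈ T then z else 1) =
      ∑ T ∈ U.powersetCard k, ∏ i ∈ T, (if i ∈ W then z else 1) := by
    intro W _
    refine Finset.sum_congr rfl fun T _ => ?_
    rw [Finset.prod_ite, Finset.prod_ite]
    simp only [Finset.prod_const, one_pow, mul_one]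
    congr 2
    rw [Finset.filter_mem_eq_inter, Finset.filter_mem_eq_inter, Finset.inter_comm]
  rw [hconv W hW]
  induction W using Finset.induction_on with
  | empty => simp [Finset.card_powersetCard]
  | insert x W hx ih =>
    have hxU : x ∈ U := hW (Finset.mem_insert_self x W)
    have ih' := ih fun i hi => hW (Finset.mem_insert_of_mem hi)
    rw [Finset.card_insert_of_notMem hx, pow_succ, ← mul_assoc]
    refine le_trans ?_ (mul_le_mul_of_nonneg_right ih' hb)
    cases k with
    | zero => simp
    | succ k =>
      set U' := U.erase x with hU'
      have hxU' : x ∉ U' := Finset.notMem_erase x U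
      have hins : U = insert x U' := (Finset.insert_erase hxU).symm
      have hcard : U.card = U'.card + 1 := by
        rw [hins, Finset.card_insert_of_notMem hxU']
      have hcongr : ∀ j, ∑ T ∈ U'.powersetCard j, ∏ i ∈ T, (if i ∈ insert x W then z else 1) =
          ∑ T ∈ U'.powersetCard j, ∏ i ∈ T, (if i ∈ W then z else 1) := by
        intro j
        refine Finset.sum_congr rfl fun T hT => Finset.prod_congr rfl fun i hi => ?_
        have : i ≠ x := fun h => hxU' (h ▸ (Finset.mem_powersetCard.1 hT).1 hi)
        simp [this]
      have e1 : ∑ T ∈ U.powersetCard (k + 1), ∏ i ∈ T, (if i ∈ insert x W then z else 1) =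
          ∑ T ∈ U'.powersetCard (k + 1), ∏ i ∈ T, (if i ∈ W then z else 1) +
          z * ∑ T ∈ U'.powersetCard k, ∏ i ∈ T, (if i ∈ W then z else 1) := by
        rw [hins, sum_powersetCard_succ_insert _ hxU', hcongr, hcongr]
        simp
      have e2 : ∑ T ∈ U.powersetCard (k + 1), ∏ i ∈ T, (if i ∈ W then z else 1) =
          ∑ T ∈ U'.powersetCard (k + 1), ∏ i ∈ T, (if i ∈ W then z else 1) +
          ∑ T ∈ U'.powersetCard k, ∏ i ∈ T, (if i ∈ W then z else 1) := by
        rw [hins, sum_powersetCard_succ_insert _ hxU']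
        simp [hx]
      rw [e1, e2]
      have hc := succ_mul_sum_powersetCard_succ_le (fun i => if i ∈ W then z else 1)
        (fun i => by split_ifs <;> linarith)
        (fun i => by split_ifs <;> linarith) U' k
      set E1 := ∑ T ∈ U'.powersetCard (k + 1), ∏ i ∈ T, (if i ∈ W then z else 1)
      set E0 := ∑ T ∈ U'.powersetCard k, ∏ i ∈ T, (if i ∈ W then z else 1)
      rw [hcard]
      push_cast
      have hN : (0 : ℝ) < (U'.card : ℝ) + 1 := Nat.cast_add_one_pos _
      -- Under the weights of `W`, which penalise other elements, `x` is selected with at least its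
      -- unweighted probability. Hence `E1 + z * E0 = (E1 + E0) - (1 - z) * E0` gains the desired
      -- factor.
      have h5 : ((k : ℝ) + 1) / (U'.card + 1) * (E1 + E0) ≤ E0 := by
        rw [div_mul_eq_mul_div, div_le_iff₀ hN]
        linarith
      have h6 := mul_le_mul_of_nonneg_right h5 (sub_nonneg.2 hz1)
      linarith

/-- Averaging over one coordinate of a uniform element of a product set. -/
theorem sum_piFinset_sum_update {β : Type*} [DecidableEq β] [Fintype α] (t : α → Finset β) (u : α)
    (F : (α → β) → ℝ) :
    ∑ S ∈ Fintype.piFinset t, ∑ T ∈ t u, F (Function.update S u T) =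
      (t u).card * ∑ S ∈ Fintype.piFinset t, F S := by
  have h : ∑ S ∈ Fintype.piFinset t, ∑ T ∈ t u, F (Function.update S u T) =
      ∑ S ∈ Fintype.piFinset t, ∑ T ∈ t u, F S := by
    rw [← Finset.sum_product', ← Finset.sum_product']
    -- Exchanging the extra value with coordinate `u` is an involution.
    refine Finset.sum_nbij' (fun p => (Function.update p.1 u p.2, p.1 u))
      (fun p => (Function.update p.1 u p.2, p.1 u)) ?_ ?_ ?_ ?_ ?_
    · intro p hp
      simp only [Finset.mem_product, Fintype.mem_piFinset] at hp ⊢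
      refine ⟨fun a => ?_, hp.1 u⟩
      by_cases ha : a = u
      · subst ha; simpa using hp.2
      · simpa [ha] using hp.1 a
    · intro p hp
      simp only [Finset.mem_product, Fintype.mem_piFinset] at hp ⊢
      refine ⟨fun a => ?_, hp.1 u⟩
      by_cases ha : a = u
      · subst ha; simpa using hp.2
      · simpa [ha] using hp.1 a
    · intro p _; simp
    · intro p _; simp
    · intro p _; rfl
  rw [h]
  simp only [Finset.sum_const, nsmul_eq_mul, Finset.mul_sum]

theorem sum_piFinset_le_of_update_le {β : Type*} [DecidableEq β] [Fintype α] (t : α → Finset β)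
    (u : α) (ht : (t u).Nonempty) (F F' : (α → β) → ℝ)
    (h : ∀ S ∈ Fintype.piFinset t, ∑ T ∈ t u, F (Function.update S u T) ≤
      ∑ T ∈ t u, F' (Function.update S u T)) :
    ∑ S ∈ Fintype.piFinset t, F S ≤ ∑ S ∈ Fintype.piFinset t, F' S := by
  have h1 := Finset.sum_le_sum h
  rw [sum_piFinset_sum_update, sum_piFinset_sum_update] at h1
  exact le_of_mul_le_mul_left h1 (by exact_mod_cast Finset.card_pos.2 ht)

end NegativeCorrelation

/-! ### Edges of a random `k`-out graph between two disjoint sets. -/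

section Selections

variable {n k : ℕ}

theorem selectionGraph_adj (S : Fin n → Finset (Fin n)) (u w : Fin n) :
    (selectionGraph S).Adj u w ↔ u ≠ w ∧ (w ∈ S u ∨ u ∈ S w) := by
  simp [selectionGraph, SimpleGraph.fromRel_adj]

theorem pow_edgeCount_selectionGraph (S : Fin n → Finset (Fin n)) {A C : Finset (Fin n)}
    (hAC : Disjoint A C) (z : ℝ) :
    z ^ edgeCount (selectionGraph S) A C =
      ∏ u ∈ A, ∏ w ∈ C, if w ∈ S u ∨ u ∈ S w then z else 1 := by
  classical
  rw [← Finset.prod_product', Finset.prod_ite]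
  simp only [Finset.prod_const, one_pow, mul_one, edgeCount]
  congr 2
  refine Finset.filter_congr fun p hp => ?_
  rw [selectionGraph_adj]
  simp only [Finset.mem_product] at hp
  have : p.1 ≠ p.2 := fun h => Finset.disjoint_left.1 hAC hp.1 (h ▸ hp.2)
  simp [this]

theorem card_selections_factor (u : Fin n) :
    ((Finset.univ.erase u).powersetCard k).card = (n - 1).choose k := by
  rw [Finset.card_powersetCard, Finset.card_erase_of_mem (Finset.mem_univ u), Finset.card_univ,
    Fintype.card_fin]

theorem card_univ_erase (u : Fin n) : (((Finset.univ.erase u).card : ℕ) : ℝ) = (n : ℝ) - 1 := by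
  have := u.pos
  rw [Finset.card_erase_of_mem (Finset.mem_univ u), Finset.card_univ, Fintype.card_fin,
    Nat.cast_sub (by omega)]
  simp

/-- The selections of the users in `A` can be averaged out one after the other. -/
theorem sum_selections_mul_le (hk : k < n) {z : ℝ} (hz0 : 0 ≤ z) (hz1 : z ≤ 1)
    (C : Finset (Fin n)) (A : Finset (Fin n)) :
    Disjoint A C → ∀ R : (Fin n → Finset (Fin n)) → ℝ, (∀ S, 0 ≤ R S) →
      (∀ S, ∀ u ∈ A, ∀ T, R (Function.update S u T) = R S) →
      ∑ S ∈ selections n k, (∏ u ∈ A, ∏ w ∈ C, if w ∈ S u ∨ u ∈ S w then z else 1) * R S ≤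
      ∑ S ∈ selections n k, (∏ u ∈ A, ∏ w ∈ C,
        if u ∈ S w then z else 1 - (k : ℝ) / (n - 1) * (1 - z)) * R S := by
  have hn : (0 : ℝ) ≤ (n : ℝ) - 1 := by
    have : (1 : ℝ) ≤ n := by exact_mod_cast (by omega : 1 ≤ n)
    linarith
  have hp0 : 0 ≤ (k : ℝ) / (n - 1) := by positivity
  have hp1 : (k : ℝ) / (n - 1) ≤ 1 := by
    refine div_le_one_of_le₀ ?_ hn
    have : (k : ℝ) + 1 ≤ n := by exact_mod_cast hk
    linarith
  have hr0 : 0 ≤ 1 - (k : ℝ) / (n - 1) * (1 - z) := by nlinarith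
  induction A using Finset.induction_on with
  | empty => intro _ R _ _; simp
  | insert u A hu ih =>
    intro hdisj R hR hRinv
    have huC : u ∉ C := Finset.disjoint_left.1 hdisj (Finset.mem_insert_self u A)
    have hAC : Disjoint A C := Finset.disjoint_left.2 fun x hx =>
      Finset.disjoint_left.1 hdisj (Finset.mem_insert_of_mem hx)
    have hneC : ∀ w ∈ C, w ≠ u := fun w hw h => huC (h ▸ hw)
    have hneA : ∀ x ∈ A, x ≠ u := fun x hx h => hu (h ▸ hx)
    set r := 1 - (k : ℝ) / (n - 1) * (1 - z) with hr
    have step1 : ∑ S ∈ selections n k,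
        (∏ x ∈ insert u A, ∏ w ∈ C, if w ∈ S x ∨ x ∈ S w then z else 1) * R S ≤
        ∑ S ∈ selections n k, (∏ x ∈ A, ∏ w ∈ C, if w ∈ S x ∨ x ∈ S w then z else 1) *
          ((∏ w ∈ C, if u ∈ S w then z else r) * R S) := by
      refine sum_piFinset_le_of_update_le _ u ?_ _ _ fun S hS => ?_
      · rw [← Finset.card_pos, card_selections_factor]
        exact Nat.choose_pos (by omega)
      · have e1 : ∀ T, (∏ x ∈ A, ∏ w ∈ C,
            if w ∈ Function.update S u T x ∨ x ∈ Function.update S u T w then z else 1) =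
            ∏ x ∈ A, ∏ w ∈ C, if w ∈ S x ∨ x ∈ S w then z else 1 := by
          intro T
          refine Finset.prod_congr rfl fun x hx => Finset.prod_congr rfl fun w hw => ?_
          rw [Function.update_of_ne (hneA x hx), Function.update_of_ne (hneC w hw)]
        have e2 : ∀ T, (∏ w ∈ C, if u ∈ Function.update S u T w then z else r) =
            ∏ w ∈ C, if u ∈ S w then z else r := by
          intro T
          refine Finset.prod_congr rfl fun w hw => ?_
          rw [Function.update_of_ne (hneC w hw)]
        -- Users of `C` that selected `u` give an edge anyway; the selection of `u` matters only for
        -- the others, and averaging over it costs at most a factor `r` each.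
        have e3 : ∀ T, (∏ w ∈ C, if w ∈ Function.update S u T u ∨ u ∈ Function.update S u T w
            then z else 1) = z ^ (C.filter fun w => u ∈ S w).card *
              ∏ w ∈ C.filter fun w => u ∉ S w, if w ∈ T then z else 1 := by
          intro T
          rw [← Finset.prod_filter_mul_prod_filter_not C (fun w => u ∈ S w), ← Finset.prod_const]
          congr 1
          · refine Finset.prod_congr rfl fun w hw => ?_
            rw [Finset.mem_filter] at hw
            rw [Function.update_of_ne (hneC w hw.1)]
            simp [hw.2]
          · refine Finset.prod_congr rfl fun w hw => ?_
            rw [Finset.mem_filter] at hw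
            rw [Function.update_of_ne (hneC w hw.1), Function.update_self]
            simp [hw.2]
        have e4 : (∏ w ∈ C, if u ∈ S w then z else r) =
            z ^ (C.filter fun w => u ∈ S w).card * r ^ (C.filter fun w => u ∉ S w).card := by
          rw [Finset.prod_ite, Finset.prod_const, Finset.prod_const]
        have hkey := sum_powersetCard_prod_le hz0 hz1 (Finset.univ.erase u) k
          (C.filter fun w => u ∉ S w) (fun w hw => Finset.mem_erase.2
            ⟨hneC w (Finset.mem_filter.1 hw).1, Finset.mem_univ w⟩)
        rw [card_univ_erase, ← hr] at hkey
        simp only [Finset.prod_insert hu, e1, e2, e3, e4, hRinv S u (Finset.mem_insert_self u A)]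
        have hA0 : 0 ≤ ∏ x ∈ A, ∏ w ∈ C, if w ∈ S x ∨ x ∈ S w then z else 1 :=
          Finset.prod_nonneg fun x _ => Finset.prod_nonneg fun w _ => by split_ifs <;> linarith
        set PA := ∏ x ∈ A, ∏ w ∈ C, if w ∈ S x ∨ x ∈ S w then z else 1
        rw [Finset.sum_const, card_selections_factor, nsmul_eq_mul]
        rw [Finset.card_erase_of_mem (Finset.mem_univ u), Finset.card_univ, Fintype.card_fin]
          at hkey
        have hpos : 0 ≤ z ^ (C.filter fun w => u ∈ S w).card * PA * R S :=
          mul_nonneg (mul_nonneg (pow_nonneg hz0 _) hA0) (hR S)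
        calc _ = (z ^ (C.filter fun w => u ∈ S w).card * PA * R S) *
              ∑ T ∈ (Finset.univ.erase u).powersetCard k,
                ∏ w ∈ C.filter fun w => u ∉ S w, (if w ∈ T then z else 1) := by
              rw [Finset.mul_sum]
              exact Finset.sum_congr rfl fun T _ => by ring
          _ ≤ _ := mul_le_mul_of_nonneg_left hkey hpos
          _ = _ := by ring
    -- The averaged factor depends only on selections made in `C`, so it may join `R` for the
    -- remaining users of `A`.
    refine step1.trans ((ih hAC (fun S => (∏ w ∈ C, if u ∈ S w then z else r) * R S) ?_ ?_).trans
      (le_of_eq ?_))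
    · intro S
      exact mul_nonneg (Finset.prod_nonneg fun w _ => by split_ifs <;> assumption) (hR S)
    · intro S x hx T
      rw [hRinv S x (Finset.mem_insert_of_mem hx)]
      congr 1
      refine Finset.prod_congr rfl fun w hw => ?_
      have hwx : w ≠ x := fun h => Finset.disjoint_left.1 hAC hx (h ▸ hw)
      rw [Function.update_of_ne hwx]
    · refine Finset.sum_congr rfl fun S _ => ?_
      rw [Finset.prod_insert hu]
      ring

/-- The generating function of the number of edges of a random `k`-out graph between two disjoint
sets is at most that of a binomial variable. -/
theorem sum_pow_edgeCount_le (hk : k < n) {z : ℝ} (hz0 : 0 < z) (hz1 : z ≤ 1)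
    {A C : Finset (Fin n)} (hAC : Disjoint A C) :
    ∑ S ∈ selections n k, z ^ edgeCount (selectionGraph S) A C ≤
      (selections n k).card *
        (1 - (1 - z) * (2 * ((k : ℝ) / (n - 1)) - ((k : ℝ) / (n - 1)) ^ 2)) ^
          (A.card * C.card) := by
  have hn : (0 : ℝ) ≤ (n : ℝ) - 1 := by
    have : (1 : ℝ) ≤ n := by exact_mod_cast (by omega : 1 ≤ n)
    linarith
  set p := (k : ℝ) / (n - 1) with hp
  have hp0 : 0 ≤ p := by positivity
  have hp1 : p ≤ 1 := by
    refine div_le_one_of_le₀ ?_ hn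
    have : (k : ℝ) + 1 ≤ n := by exact_mod_cast hk
    linarith
  set r := 1 - p * (1 - z) with hr
  have hzr : z ≤ r := by nlinarith
  have hr0 : 0 < r := hz0.trans_le hzr
  have h1 := sum_selections_mul_le hk hz0.le hz1 C A hAC (fun _ => 1) (fun _ => zero_le_one)
    (fun _ _ _ _ => rfl)
  simp only [mul_one, ← pow_edgeCount_selectionGraph _ hAC] at h1
  refine h1.trans ?_
  have h2 : ∀ S : Fin n → Finset (Fin n), (∏ u ∈ A, ∏ w ∈ C, if u ∈ S w then z else r) =
      ∏ w, if w ∈ C then r ^ A.card * ∏ u ∈ A, (if u ∈ S w then z / r else 1) else 1 := by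
    intro S
    rw [Finset.prod_comm, Finset.prod_ite_mem, Finset.univ_inter]
    refine Finset.prod_congr rfl fun w _ => ?_
    rw [← Finset.prod_const, ← Finset.prod_mul_distrib]
    refine Finset.prod_congr rfl fun u _ => ?_
    split_ifs
    · field_simp
    · ring
  rw [← hp, ← hr]
  simp only [h2]
  have h3 := Finset.prod_univ_sum (fun u : Fin n => (Finset.univ.erase u).powersetCard k)
    (fun w T => if w ∈ C then r ^ A.card * ∏ u ∈ A, (if u ∈ T then z / r else 1) else 1)
  rw [selections, ← h3, Fintype.card_piFinset, Nat.cast_prod]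
  -- Averaging over `C` now uses the weight `z / r`, and `r (1 - p (1 - z/r))` is the generating
  -- function of one edge of probability `2p - p² = 1 - (1 - p)²`.
  have h4 : (1 - (1 - z) * (2 * p - p ^ 2)) ^ (A.card * C.card) =
      ∏ w : Fin n, if w ∈ C then (r * (1 - p * (1 - z / r))) ^ A.card else 1 := by
    rw [Finset.prod_ite_mem, Finset.univ_inter, Finset.prod_const, pow_mul]
    congr 2
    field_simp
    rw [hr]
    ring
  rw [h4, ← Finset.prod_mul_distrib]
  refine Finset.prod_le_prod (fun w _ => Finset.sum_nonneg fun T _ => ?_) fun w _ => ?_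
  · split_ifs
    · exact mul_nonneg (pow_nonneg hr0.le _)
        (Finset.prod_nonneg fun u _ => by split_ifs <;> positivity)
    · exact zero_le_one
  · by_cases hw : w ∈ C
    · simp only [hw, if_true]
      have hkey := sum_powersetCard_prod_le (div_nonneg hz0.le hr0.le)
        (div_le_one_of_le₀ hzr hr0.le) (Finset.univ.erase w) k A (fun u hu => Finset.mem_erase.2
          ⟨fun h => Finset.disjoint_left.1 hAC hu (h ▸ hw), Finset.mem_univ u⟩)
      rw [card_univ_erase, ← hp, ← Finset.card_powersetCard] at hkey
      rw [← Finset.mul_sum, mul_pow]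
      calc _ ≤ r ^ A.card * _ := mul_le_mul_of_nonneg_left hkey (pow_nonneg hr0.le _)
        _ = _ := by ring
    · simp [hw]

theorem log_three_lt : Real.log 3 < 1.0987 := by
  rw [Real.log_lt_iff_lt_exp (by norm_num)]
  have h := Real.sum_le_exp_of_nonneg (x := 1.0987) (by norm_num) 10
  refine lt_of_lt_of_le ?_ h
  norm_num [Finset.sum_range_succ, Nat.factorial]

/-- The probability that there are few edges between two given sets. -/
theorem card_filter_edgeCount_lt_le (hk : k < n) {A C : Finset (Fin n)} (hAC : Disjoint A C)
    (θ : ℝ) :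
    (((selections n k).filter fun S => (edgeCount (selectionGraph S) A C : ℝ) < θ).card : ℝ) ≤
      (selections n k).card * Real.exp (1.0987 * θ - 2 / 3 *
        (2 * ((k : ℝ) / (n - 1)) - ((k : ℝ) / (n - 1)) ^ 2) * A.card * C.card) := by
  rcases le_or_gt θ 0 with hθ | hθ
  · rw [Finset.filter_false_of_mem (fun S _ => not_lt.2 (hθ.trans (Nat.cast_nonneg _)))]
    simp only [Finset.card_empty, Nat.cast_zero]
    positivity
  -- Chernoff bound with the fixed weight `1/3`; the constant `1.0987` is an upper bound for `log
  -- 3`.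
  have hs := sum_pow_edgeCount_le (z := 1 / 3) hk (by norm_num) (by norm_num) hAC
  set x := 2 * ((k : ℝ) / (n - 1)) - ((k : ℝ) / (n - 1)) ^ 2 with hx
  have hx1 : x ≤ 1 := by nlinarith [sq_nonneg ((k : ℝ) / (n - 1) - 1)]
  have h1 : (1 - (1 - 1 / 3 : ℝ) * x) ^ (A.card * C.card) ≤
      Real.exp (-(2 / 3 * x * A.card * C.card)) := by
    calc _ ≤ Real.exp (-(2 / 3 * x)) ^ (A.card * C.card) := by
          refine pow_le_pow_left₀ (by linarith) ?_ _
          have := Real.add_one_le_exp (-(2 / 3 * x))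
          linarith
      _ = _ := by
          rw [← Real.exp_nat_mul]
          congr 1
          push_cast
          ring
  have h2 : (((selections n k).filter fun S => (edgeCount (selectionGraph S) A C : ℝ) < θ).card : ℝ)
      * Real.exp (-(1.0987 * θ)) ≤
      ∑ S ∈ selections n k, (1 / 3 : ℝ) ^ edgeCount (selectionGraph S) A C := by
    rw [← nsmul_eq_mul, ← Finset.sum_const]
    refine (Finset.sum_le_sum fun S hS => ?_).trans (Finset.sum_le_sum_of_subset_of_nonneg
      (Finset.filter_subset _ _) fun S _ _ => by positivity)
    have hlt := (Finset.mem_filter.1 hS).2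
    rw [← Real.exp_log (show (0 : ℝ) < 1 / 3 by norm_num), ← Real.exp_nat_mul, one_div,
      Real.log_inv]
    refine Real.exp_le_exp.2 ?_
    have := log_three_lt
    have h3 : 0 < Real.log 3 := Real.log_pos (by norm_num)
    nlinarith
  have h4 := h2.trans (hs.trans (mul_le_mul_of_nonneg_left h1 (Nat.cast_nonneg _)))
  have h5 : Real.exp (1.0987 * θ - 2 / 3 * x * A.card * C.card) =
      Real.exp (-(2 / 3 * x * A.card * C.card)) / Real.exp (-(1.0987 * θ)) := by
    rw [← Real.exp_sub]; congr 1; ring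
  rw [h5, ← mul_div_assoc, le_div_iff₀ (Real.exp_pos _)]
  exact h4

end Selections

/-! ### Numerical estimates for the union bound over cuts. -/

section UnionBound

theorem log_three_gt : 1.09 < Real.log 3 := by
  rw [Real.lt_log_iff_exp_lt (by norm_num)]
  have h1 : Real.exp 1.09 = Real.exp 1 * Real.exp 0.09 := by rw [← Real.exp_add]; norm_num
  have h2 : Real.exp 0.09 ≤ 1 / 0.91 := by
    have := Real.add_one_le_exp (-0.09)
    rw [Real.exp_neg] at this
    rw [le_div_iff₀ (by norm_num)]
    have h3 := Real.exp_pos 0.09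
    calc _ ≤ Real.exp 0.09 * (Real.exp 0.09)⁻¹ := by gcongr; linarith
      _ = 1 := mul_inv_cancel₀ h3.ne'
  have h3 := Real.exp_one_lt_d9
  rw [h1]
  calc _ ≤ 2.7182818286 * (1 / 0.91 : ℝ) := by gcongr
    _ < 3 := by norm_num

theorem log_two_mul_gt {m : ℝ} (hm : 81 ≤ m) : 5.05 < Real.log (2 * m) := by
  have h1 : Real.log (2 * 3 ^ 4) ≤ Real.log (2 * m) :=
    Real.log_le_log (by norm_num) (by linarith)
  rw [Real.log_mul (by norm_num) (by norm_num), Real.log_pow] at h1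
  have h2 := log_three_gt
  have h3 := Real.log_two_gt_d9
  push_cast at h1
  linarith

/-- The bound `(e m / b)^b`, from `b^b / b! ≤ e^b`. -/
theorem choose_le_exp (m b : ℕ) (hb : 0 < b) (hm : 0 < m) :
    (m.choose b : ℝ) ≤ Real.exp (b * (1 - Real.log (b / m))) := by
  have hb' : (0 : ℝ) < b := by exact_mod_cast hb
  have hm' : (0 : ℝ) < m := by exact_mod_cast hm
  have h1 := Real.pow_div_factorial_le_exp (x := (b : ℝ)) hb'.le b
  have h2 : (m.choose b : ℝ) ≤ (m : ℝ) ^ b / b.factorial := Nat.choose_le_pow_div b m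
  have h3 : Real.exp (b * (1 - Real.log (b / m))) = Real.exp b * ((m : ℝ) / b) ^ b := by
    rw [mul_sub, mul_one, sub_eq_add_neg, Real.exp_add, ← mul_neg, ← Real.log_inv, inv_div,
      Real.exp_nat_mul, Real.exp_log (by positivity)]
  rw [h3]
  refine h2.trans ?_
  have hf : (0 : ℝ) < b.factorial := by exact_mod_cast b.factorial_pos
  calc (m : ℝ) ^ b / b.factorial = (b : ℝ) ^ b / b.factorial * ((m : ℝ) / b) ^ b := by
        rw [div_pow]; field_simp
    _ ≤ _ := by gcongr

/-- Entropy against the exponent of the edge count, for sets of relative size `y`. -/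
theorem entropy_exponent_le {m y : ℝ} (hm : 81 ≤ m) (hy : 3 / m ≤ y) (hy2 : y ≤ 1 / 2) :
    1 + Real.log 2 - Real.log y - 1.08 * (1 - y) * Real.log (2 * m) ≤ -0.25 := by
  have hl := log_two_mul_gt hm
  have hm0 : 0 < m := by linarith
  set l := Real.log (2 * m) with hldef
  -- By convexity in `y` it suffices to check the endpoints `3/m` and `1/2`.
  have hconv : ConvexOn ℝ (Set.Ioi 0) fun y : ℝ =>
      -Real.log y + ((1.08 * l) * y + (1 + Real.log 2 - 1.08 * l)) := by
    refine ConvexOn.add strictConcaveOn_log_Ioi.concaveOn.neg (ConvexOn.add ?_ (convexOn_const _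
      (convex_Ioi 0)))
    exact (convexOn_id (convex_Ioi 0)).smul (c := 1.08 * l) (by linarith)
  have h1 := hconv.le_max_of_mem_Icc (x := 3 / m) (y := 1 / 2) (z := y)
    (show (0 : ℝ) < 3 / m by positivity) (show (0 : ℝ) < 1 / 2 by norm_num) ⟨hy, hy2⟩
  have h2 : -Real.log (3 / m) + ((1.08 * l) * (3 / m) + (1 + Real.log 2 - 1.08 * l)) ≤ -0.25 := by
    have e : Real.log (3 / m) = Real.log 3 + Real.log 2 - l := by
      rw [hldef, Real.log_div (by norm_num) hm0.ne', Real.log_mul (by norm_num) hm0.ne']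
      ring
    have h3 : 3 / m ≤ 1 / 27 := by
      rw [div_le_div_iff₀ hm0 (by norm_num)]; linarith
    have := log_three_gt
    rw [e]
    nlinarith
  have h3 : -Real.log (1 / 2) + ((1.08 * l) * (1 / 2) + (1 + Real.log 2 - 1.08 * l)) ≤ -0.25 := by
    have := Real.log_two_lt_d9
    rw [one_div, Real.log_inv]
    linarith
  have h4 := h1.trans (max_le h2 h3)
  linarith

/-- The binomials count the cuts: the complement of `C` has `b` elements, and `A` is an `a`-subset
of it. -/
theorem union_bound_term_le {m a : ℕ} (hm : 81 ≤ m) (ha : 1 ≤ a) (ham : a ≤ m / 2)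
    {b c : ℕ} (hb : b = min (2 * a - 1) (m / 2)) (hc : c = m - b) :
    (m.choose b : ℝ) * b.choose a * Real.exp (-(2.16 * a * c / m * Real.log (2 * m))) ≤
      0.07 * 0.8 ^ a := by
  have hmR : (81 : ℝ) ≤ m := by exact_mod_cast hm
  have hm0 : (0 : ℝ) < m := by linarith
  have hl := log_two_mul_gt hmR
  set l := Real.log (2 * m) with hldef
  -- For `a = 1` also `b = 1`, below the range `b ≥ 3` of the entropy estimate.
  rcases Nat.eq_or_lt_of_le ha with rfl | ha2
  · obtain rfl : b = 1 := by omega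
    have hcR : (c : ℝ) = m - 1 := by
      rw [hc, Nat.cast_sub (by omega)]; simp
    have h1 : 2 ≤ 2.16 * ((1 : ℕ) : ℝ) * c / m := by
      rw [le_div_iff₀ hm0, hcR]; push_cast; linarith
    have h2 : Real.exp (-(2.16 * ((1 : ℕ) : ℝ) * c / m * l)) ≤ Real.exp (-(2 * l)) :=
      Real.exp_le_exp.2 (by nlinarith)
    have h3 : Real.exp (-(2 * l)) = 1 / (2 * m) ^ 2 := by
      rw [Real.exp_neg, two_mul, Real.exp_add, hldef, Real.exp_log (by positivity), one_div, sq]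
    rw [h3] at h2
    simp only [Nat.choose_one_right, Nat.choose_self, Nat.cast_one, mul_one, pow_one] at h2 ⊢
    calc _ ≤ (m : ℝ) * (1 / (2 * m) ^ 2) := by gcongr
      _ = 1 / (4 * m) := by field_simp; ring
      _ ≤ 1 / (4 * 81) := by gcongr
      _ ≤ _ := by norm_num
  · have hb3 : 3 ≤ b := by omega
    have hab : a ≤ b := by omega
    have hb2a : b + 1 ≤ 2 * a := by omega
    have hbm : 2 * b ≤ m := by omega
    have hb3R : (3 : ℝ) ≤ b := by exact_mod_cast hb3
    have hb2aR : (b : ℝ) + 1 ≤ 2 * a := by exact_mod_cast hb2a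
    have hbmR : 2 * (b : ℝ) ≤ m := by exact_mod_cast hbm
    have habR : (a : ℝ) ≤ b := by exact_mod_cast hab
    set y : ℝ := b / m with hy
    have hy1 : 3 / (m : ℝ) ≤ y := by rw [hy]; gcongr
    have hy2 : y ≤ 1 / 2 := by
      rw [hy, div_le_div_iff₀ hm0 (by norm_num)]; linarith
    have hcy : (c : ℝ) / m = 1 - y := by
      rw [hc, Nat.cast_sub (by omega), hy]; field_simp
    have hent := entropy_exponent_le hmR hy1 hy2
    rw [← hldef] at hent
    have h1 := choose_le_exp m b (by omega) (by omega)
    rw [← hy] at h1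
    have h2 : (b.choose a : ℝ) ≤ Real.exp (b * Real.log 2) := by
      rw [Real.exp_nat_mul, Real.exp_log (by norm_num)]
      exact_mod_cast Nat.choose_le_two_pow b a
    -- Since `b + 1 ≤ 2a`, one unit beyond `b` is left over; it supplies the factor `exp (-2.7) ≤
    -- 0.07`.
    have h3 : (1 - y) * l * (1.08 * (b + 1)) ≤ 2.16 * a * c / m * l := by
      have : 2.16 * a * c / m * l = (1 - y) * l * (2.16 * a) := by rw [← hcy]; ring
      rw [this]
      have h0 : 0 ≤ (1 - y) * l := mul_nonneg (by linarith) (by linarith)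
      exact mul_le_mul_of_nonneg_left (by linarith) h0
    have h4 : (b : ℝ) * (1 + Real.log 2 - Real.log y - 1.08 * (1 - y) * l) ≤ b * (-0.25) :=
      mul_le_mul_of_nonneg_left hent (by linarith)
    have h5 : 0.5 * 5.05 ≤ (1 - y) * l := by nlinarith
    calc _ ≤ Real.exp (b * (1 - Real.log y)) * Real.exp (b * Real.log 2) *
          Real.exp (-(2.16 * a * c / m * l)) := by gcongr
      _ = Real.exp (b * (1 - Real.log y) + b * Real.log 2 - 2.16 * a * c / m * l) := by
          rw [← Real.exp_add, ← Real.exp_add]; congr 1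
      _ ≤ Real.exp (-2.7 + a * (-0.25)) := by
          refine Real.exp_le_exp.2 ?_
          nlinarith
      _ = Real.exp (-2.7) * Real.exp (-0.25) ^ a := by rw [Real.exp_add, Real.exp_nat_mul]
      _ ≤ 0.07 * 0.8 ^ a := by
          have h6 : Real.exp (-0.25) ≤ 0.8 := by
            rw [Real.exp_neg, inv_le_comm₀ (Real.exp_pos _) (by norm_num)]
            have := Real.add_one_le_exp (0.25 : ℝ)
            norm_num at this ⊢
            linarith
          have h7 : Real.exp (-2.7) ≤ 0.07 := by
            rw [Real.exp_neg, inv_le_comm₀ (Real.exp_pos _) (by norm_num)]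
            have h := Real.sum_le_exp_of_nonneg (x := 2.7) (by norm_num) 8
            refine le_trans ?_ h
            norm_num [Finset.sum_range_succ, Nat.factorial]
          gcongr

theorem union_bound_le {m : ℕ} (hm : 81 ≤ m) {d δ : ℝ} (hδ0 : 0 < δ) (hδ1 : δ ≤ 1)
    (hd : 4 * Real.log (2 * m / δ) ≤ d) :
    ∑ a ∈ Finset.Icc 1 (m / 2), (m.choose (min (2 * a - 1) (m / 2)) : ℝ) *
      (min (2 * a - 1) (m / 2)).choose a *
      Real.exp (-(0.54 * d * a * (m - min (2 * a - 1) (m / 2) : ℕ) / m)) ≤ 2 / 3 * δ := by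
  have hmR : (81 : ℝ) ≤ m := by exact_mod_cast hm
  have hm0 : (0 : ℝ) < m := by linarith
  have hterm : ∀ a ∈ Finset.Icc 1 (m / 2), (m.choose (min (2 * a - 1) (m / 2)) : ℝ) *
      (min (2 * a - 1) (m / 2)).choose a *
      Real.exp (-(0.54 * d * a * (m - min (2 * a - 1) (m / 2) : ℕ) / m)) ≤ 0.07 * 0.8 ^ a * δ := by
    intro a ha
    rw [Finset.mem_Icc] at ha
    set b := min (2 * a - 1) (m / 2) with hb
    set c := m - b with hc
    have h1 := union_bound_term_le hm ha.1 ha.2 hb hc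
    have hc2 : (m : ℝ) ≤ 2 * c := by exact_mod_cast (by omega : m ≤ 2 * c)
    have ha1 : (1 : ℝ) ≤ a := by exact_mod_cast ha.1
    have hE : (1 : ℝ) ≤ 2.16 * a * c / m := by
      -- The exponent is at least 1, so the `log (1/δ)` in `d / 4` yields a full factor `δ` in every
      -- term.
      rw [le_div_iff₀ hm0]
      nlinarith
    have hlogδ : Real.log δ ≤ 0 := Real.log_nonpos hδ0.le hδ1
    rw [Real.log_div (by positivity) hδ0.ne'] at hd
    have h2 : Real.exp (-(0.54 * d * a * c / m)) ≤
        Real.exp (-(2.16 * a * c / m * Real.log (2 * m))) * δ := by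
      nth_rewrite 1 [← Real.exp_log hδ0]
      rw [← Real.exp_add]
      refine Real.exp_le_exp.2 ?_
      have h3 : 0.54 * d * a * c / m = (2.16 * a * c / m) * (d / 4) := by ring
      rw [h3]
      nlinarith
    calc _ ≤ (m.choose b : ℝ) * b.choose a *
          (Real.exp (-(2.16 * a * c / m * Real.log (2 * m))) * δ) := by gcongr
      _ = (m.choose b : ℝ) * b.choose a *
          Real.exp (-(2.16 * a * c / m * Real.log (2 * m))) * δ := by ring
      _ ≤ _ := by gcongr
  refine (Finset.sum_le_sum hterm).trans ?_
  rw [← Finset.sum_mul, ← Finset.mul_sum]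
  gcongr
  have hgeo : ∑ a ∈ Finset.Icc 1 (m / 2), (0.8 : ℝ) ^ a ≤ 5 := by
    calc _ ≤ ∑ a ∈ Finset.range (m / 2 + 1), (0.8 : ℝ) ^ a :=
          Finset.sum_le_sum_of_subset_of_nonneg (fun a ha => by
            rw [Finset.mem_Icc] at ha; rw [Finset.mem_range]; omega) fun a _ _ => by positivity
      _ ≤ 5 := by
          rw [geom_sum_eq (by norm_num)]
          have : (0 : ℝ) < 0.8 ^ (m / 2 + 1) := by positivity
          rw [div_le_iff_of_neg (by norm_num)]
          linarith
  linarith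

end UnionBound

/-! ### From an energy bound to differential privacy. -/

variable {n : ℕ}

theorem isProbabilityMeasure_gopa (G : SimpleGraph (Fin n)) (H : Finset (Fin n))
    (varEta varDelta : ℝ≥0) (ν : ProbabilityMeasure (Noise n)) (X : Fin n → ℝ) :
    IsProbabilityMeasure (gopa G H varEta varDelta ν X) := by
  have : IsProbabilityMeasure (protocolNoise n varEta varDelta) := by
    unfold protocolNoise; infer_instance
  exact Measure.isProbabilityMeasure_map (measurable_view G H X).aemeasurable

theorem privacy_budget_eq {m ε c κ B : ℝ} (hm : m ≠ 0) (hε : ε ≠ 0) (hc : c ^ 2 ≠ 0) (hκ : 0 < κ)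
    (hB : B ≠ 0) :
    (1 / m / (c ^ 2 / (m * ε ^ 2)) + B / (κ * (c ^ 2 / (m * ε ^ 2)) * m * B)) *
      (κ / (κ + 1) * c ^ 2) = ε ^ 2 := by
  have h1 : κ + 1 ≠ 0 := by positivity
  have h2 : c ≠ 0 := fun h => hc (by rw [h]; norm_num)
  field_simp

/-- The current on the honest subgraph, extended by zero, is the flow. The choice of `varDelta`
makes the budget come out exactly, with `κ/(κ+1) c²` as the constant of the Gaussian mechanism. -/
theorem gopa_le_of_potential (G : SimpleGraph (Fin n)) (H : Finset (Fin n))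
    (v : (H : Set (Fin n))) {f : ↥(H : Set (Fin n)) → ℝ} {B : ℝ} (hB : 0 < B)
    (hf : ∀ u, ∑ w, edgeFlow (G.induce (H : Set (Fin n))) f u w =
      (if u = v then 1 else 0) - 1 / (Fintype.card (H : Set (Fin n)) : ℝ))
    (hE : (∑ u, ∑ w, edgeFlow (G.induce (H : Set (Fin n))) f u w ^ 2) / 2 ≤ B)
    {ε δ δ' c κ : ℝ} (hε0 : 0 < ε) (hε1 : ε < 1) (hδ'0 : 0 < δ') (hδ'1 : δ' < 1)
    (hc : 2 * Real.log (1.25 / δ') < c ^ 2) (hκ : 0 < κ)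
    {varEta varDelta : ℝ≥0} (hEta : (varEta : ℝ) = c ^ 2 / (H.card * ε ^ 2))
    (hDelta : (varDelta : ℝ) = κ * varEta * H.card * B)
    (hδ : 1.25 * (δ' / 1.25) ^ (κ / (κ + 1)) ≤ δ)
    (ν : ProbabilityMeasure (Noise n)) {X X' : Fin n → ℝ}
    (hX : ∀ u, X u ∈ Set.Icc (0 : ℝ) 1) (hX' : ∀ u, X' u ∈ Set.Icc (0 : ℝ) 1)
    (hXX' : ∀ u, u ≠ (v : Fin n) → X u = X' u) {O : Set (View n H)} (hO : MeasurableSet O) :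
    gopa G H varEta varDelta ν X O ≤
      ENNReal.ofReal (Real.exp ε) * gopa G H varEta varDelta ν X' O + ENNReal.ofReal δ := by
  classical
  have hvH : (v : Fin n) ∈ H := v.2
  have hm : (0 : ℝ) < H.card := by exact_mod_cast Finset.card_pos.2 ⟨(v : Fin n), hvH⟩
  have hcard : Fintype.card (H : Set (Fin n)) = H.card := Fintype.card_coe H
  have hbase : 0 < (δ' / 1.25) ^ (κ / (κ + 1)) := Real.rpow_pos_of_pos (by positivity) _
  have hδ0 : 0 < δ := lt_of_lt_of_le (by positivity) hδ
  have hlog0 : 0 < Real.log (1.25 / δ') := Real.log_pos (by rw [lt_div_iff₀ hδ'0]; linarith)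
  have hc0 : 0 < c ^ 2 := by linarith
  have hEpos : (0 : ℝ) < varEta := by rw [hEta]; positivity
  have hDpos : (0 : ℝ) < varDelta := by rw [hDelta]; positivity
  have hs : 0 < κ / (κ + 1) := by positivity
  have hC : 2 * Real.log (1.25 / δ) < κ / (κ + 1) * c ^ 2 := by
    have h1 : Real.log (1.25 * (δ' / 1.25) ^ (κ / (κ + 1))) ≤ Real.log δ :=
      Real.log_le_log (by positivity) hδ
    rw [Real.log_mul (by norm_num) hbase.ne', Real.log_rpow (by positivity),
      Real.log_div hδ'0.ne' (by norm_num)] at h1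
    rw [Real.log_div (by norm_num) hδ'0.ne'] at hc
    rw [Real.log_div (by norm_num) hδ0.ne']
    have h2 := mul_lt_mul_of_pos_left hc hs
    linarith
  set g : Fin n → Fin n → ℝ := fun u w =>
    if h : u ∈ H ∧ w ∈ H then
      edgeFlow (G.induce (H : Set (Fin n))) f ⟨u, h.1⟩ ⟨w, h.2⟩ else 0 with hg
  have hgsub : ∀ u w : (H : Set (Fin n)),
      g u w = edgeFlow (G.induce (H : Set (Fin n))) f u w := by
    intro u w
    have h1 : (u : Fin n) ∈ H := u.2
    have h2 : (w : Fin n) ∈ H := w.2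
    simp only [hg, h1, h2, and_self, dif_pos]
  have hsum : ∀ F : Fin n → ℝ, (∀ u, u ∉ H → F u = 0) →
      ∑ u, F u = ∑ u : (H : Set (Fin n)), F u := by
    intro F hF
    rw [← Finset.sum_subset (Finset.subset_univ H) fun u _ hu => hF u hu]
    exact (Finset.sum_coe_sort H F).symm
  have hg0 : ∀ u w, ¬ (u ∈ H ∧ w ∈ H) → g u w = 0 := fun u w h => dif_neg h
  have hanti : ∀ u w, g w u = - g u w := by
    intro u w
    by_cases h : u ∈ H ∧ w ∈ H
    · exact (hgsub ⟨w, h.2⟩ ⟨u, h.1⟩).trans ((edgeFlow_antisymm _ f _ _).trans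
        (congrArg Neg.neg (hgsub ⟨u, h.1⟩ ⟨w, h.2⟩).symm))
    · rw [hg0 u w h, hg0 w u (fun h' => h h'.symm), neg_zero]
  refine gopa_le_of_flow G H hvH g hanti ?_ ?_ (by exact_mod_cast hEpos.ne')
    (by exact_mod_cast hDpos.ne') hε0 hε1 hδ0 hC (by positivity) ?_ ν hX hX' hXX' hO
  · intro u w h
    by_cases h' : u ∈ H ∧ w ∈ H
    · have hadj : ¬ G.Adj u w := fun ha => h ⟨h'.1, h'.2, ha⟩
      rw [hgsub ⟨u, h'.1⟩ ⟨w, h'.2⟩]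
      exact if_neg hadj
    · exact hg0 u w h'
  · intro u hu
    rw [hsum _ fun w hw => hg0 u w fun h => hw h.2]
    have h1 := hf ⟨u, hu⟩
    rw [hcard] at h1
    simp only [← hgsub, Subtype.ext_iff] at h1
    exact h1
  · have h1 : (∑ u, ∑ w, g u w ^ 2) =
        ∑ u, ∑ w, edgeFlow (G.induce (H : Set (Fin n))) f u w ^ 2 := by
      rw [hsum _ fun u hu => Finset.sum_eq_zero fun w _ => by
        rw [hg0 u w fun h => hu h.1]; norm_num]
      refine Finset.sum_congr rfl fun u _ => ?_
      rw [hsum _ fun w hw => by rw [hg0 u w fun h => hw h.2]; norm_num]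
      exact Finset.sum_congr rfl fun w _ => by rw [hgsub]
    rw [h1]
    have h2 : (∑ u, ∑ w, edgeFlow (G.induce (H : Set (Fin n))) f u w ^ 2) / 2 / varDelta ≤
        B / varDelta := div_le_div_of_nonneg_right hE hDpos.le
    have h3 : (1 / H.card / varEta + B / varDelta) * (κ / (κ + 1) * c ^ 2) = ε ^ 2 := by
      rw [hDelta, hEta]
      exact privacy_budget_eq hm.ne' hε0.ne' hc0.ne' hκ hB.ne'
    rw [← h3]
    refine mul_le_mul_of_nonneg_right ?_ (by positivity)
    linarith

/-! ### Expansion of the honest part of a random `k`-out graph. -/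

theorem edgeCount_induce (G : SimpleGraph (Fin n)) (H : Finset (Fin n))
    (A C : Finset (H : Set (Fin n))) :
    edgeCount (G.induce (H : Set (Fin n))) A C =
      edgeCount G (A.map (Function.Embedding.subtype _)) (C.map (Function.Embedding.subtype _)) := by
  classical
  refine Finset.card_bij (fun p _ => ((p.1 : Fin n), (p.2 : Fin n))) ?_ ?_ ?_
  · intro p hp
    simp only [Finset.mem_filter, Finset.mem_product] at hp ⊢
    exact ⟨⟨Finset.mem_map_of_mem _ hp.1.1, Finset.mem_map_of_mem _ hp.1.2⟩, hp.2⟩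
  · intro p _ p' _ h
    simp only [Prod.mk.injEq] at h
    exact Prod.ext (Subtype.ext h.1) (Subtype.ext h.2)
  · rintro ⟨u, w⟩ hp
    simp only [Finset.mem_filter, Finset.mem_product] at hp
    obtain ⟨u, hu, rfl⟩ := Finset.mem_map.1 hp.1.1
    obtain ⟨w, hw, rfl⟩ := Finset.mem_map.1 hp.1.2
    refine ⟨(u, w), ?_, rfl⟩
    simp only [Finset.mem_filter, Finset.mem_product]
    exact ⟨⟨hu, hw⟩, hp.2⟩

/-- The selections for which some small set of honest users has few edges to a large one. -/
def SparseCut (H : Finset (Fin n)) (τ : ℝ) (S : Fin n → Finset (Fin n)) : Prop :=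
  ∃ a ∈ Finset.Icc 1 (H.card / 2),
    ∃ C ∈ H.powersetCard (H.card - min (2 * a - 1) (H.card / 2)),
      ∃ A ∈ (H \ C).powersetCard a,
        (edgeCount (selectionGraph S) A C : ℝ) < τ * a * C.card / H.card

/-- Adjacency of two honest users is decided by their own selections, so what malicious users select
is irrelevant. -/
theorem isExpanding_of_not_sparseCut {H : Finset (Fin n)} {τ : ℝ} {S M : Fin n → Finset (Fin n)}
    (hM : ∀ u ∈ H, M u = S u) (h : ¬ SparseCut H τ S) :
    IsExpanding ((selectionGraph M).induce (H : Set (Fin n))) τ := by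
  classical
  have hcard : Fintype.card (H : Set (Fin n)) = H.card := Fintype.card_coe H
  intro A C hAC hA1 hA2 hC
  rw [hcard] at hA2 hC ⊢
  rw [edgeCount_induce]
  set ι := Function.Embedding.subtype fun u => u ∈ (H : Set (Fin n)) with hι
  have hsub : ∀ A : Finset (H : Set (Fin n)), A.map ι ⊆ H := by
    intro A u hu
    obtain ⟨u, -, rfl⟩ := Finset.mem_map.1 hu
    exact u.2
  have heq : edgeCount (selectionGraph M) (A.map ι) (C.map ι) =
      edgeCount (selectionGraph S) (A.map ι) (C.map ι) := by
    unfold edgeCount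
    congr 1
    refine Finset.filter_congr fun p hp => ?_
    rw [Finset.mem_product] at hp
    rw [selectionGraph_adj, selectionGraph_adj, hM _ (hsub A hp.1), hM _ (hsub C hp.2)]
  rw [heq]
  by_contra hcon
  push Not at hcon
  refine h ⟨A.card, Finset.mem_Icc.2 ⟨hA1, hA2⟩, C.map ι, Finset.mem_powersetCard.2
    ⟨hsub C, by rw [Finset.card_map, hC]⟩, A.map ι, Finset.mem_powersetCard.2
    ⟨fun u hu => Finset.mem_sdiff.2 ⟨hsub A hu, fun hu' => ?_⟩, Finset.card_map _⟩, ?_⟩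
  · exact Finset.disjoint_left.1 ((Finset.disjoint_map ι).2 hAC) hu hu'
  · rwa [Finset.card_map]

open Classical in
theorem card_filter_sparseCut_le {k : ℕ} (hk : k < n) (H : Finset (Fin n)) (hm : 81 ≤ H.card)
    {δ : ℝ} (hδ0 : 0 < δ) (hδ1 : δ ≤ 1)
    (hd : 4 * Real.log (2 * H.card / δ) ≤ H.card * ((k : ℝ) / n)) :
    (((selections n k).filter fun S => SparseCut H
      (2 / 3 * (H.card * ((k : ℝ) / n)) * (1 - 5 / 6 * ((k : ℝ) / n))) S).card : ℝ) ≤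
      (selections n k).card * (2 / 3 * δ) := by
  set m := H.card with hmdef
  set β : ℝ := (k : ℝ) / n with hβ
  set d : ℝ := m * β with hdd
  set τ : ℝ := 2 / 3 * d * (1 - 5 / 6 * β) with hτ
  have hm0 : (0 : ℝ) < m := by exact_mod_cast (by omega : 0 < m)
  have hn1 : (k : ℝ) + 1 ≤ n := by exact_mod_cast hk
  have hk0 : (0 : ℝ) ≤ k := Nat.cast_nonneg k
  have hn0 : (0 : ℝ) < n := by linarith
  have hβ0 : 0 ≤ β := div_nonneg hk0 hn0.le
  have hβ1 : β ≤ 1 := div_le_one_of_le₀ (by linarith) hn0.le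
  set p : ℝ := (k : ℝ) / (n - 1) with hp
  have hpβ : β ≤ p := by
    rcases eq_or_lt_of_le hk0 with h0 | h0
    · rw [hβ, hp, ← h0]; simp
    · exact div_le_div_of_nonneg_left hk0 (by linarith) (by linarith)
  have hp1 : p ≤ 1 := div_le_one_of_le₀ (by linarith) (by linarith)
  set bb : ℕ → ℕ := fun a => min (2 * a - 1) (m / 2) with hbb
  have hone : ∀ a ∈ Finset.Icc 1 (m / 2), ∀ C ∈ H.powersetCard (m - bb a),
      ∀ A ∈ (H \ C).powersetCard a,
      (((selections n k).filter fun S =>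
        (edgeCount (selectionGraph S) A C : ℝ) < τ * a * C.card / m).card : ℝ) ≤
      (selections n k).card * Real.exp (-(0.54 * d * a * (m - bb a : ℕ) / m)) := by
    intro a _ C hC A hA
    rw [Finset.mem_powersetCard] at hC hA
    have hAC : Disjoint A C := Finset.disjoint_left.2 fun u hu =>
      (Finset.mem_sdiff.1 (hA.1 hu)).2
    refine (card_filter_edgeCount_lt_le hk hAC _).trans
      (mul_le_mul_of_nonneg_left (Real.exp_le_exp.2 ?_) (Nat.cast_nonneg _))
    rw [hA.2, hC.2, ← hp]
    set c : ℝ := ((m - bb a : ℕ) : ℝ) with hc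
    have hc0 : 0 ≤ c := Nat.cast_nonneg _
    have ha0 : (0 : ℝ) ≤ a := Nat.cast_nonneg a
    have h1 : 2 * β - β ^ 2 ≤ 2 * p - p ^ 2 := by nlinarith
    have h2 : τ * a * c / m = 2 / 3 * β * (1 - 5 / 6 * β) * (a * c) := by
      rw [hτ, hdd]; field_simp
    have h3 : 0.54 * d * a * c / m = 0.54 * β * (a * c) := by
      rw [hdd]; field_simp
    -- After `p` is replaced by `β`, the left side is about `-0.601 β + 0.057 β²`. The factor `1 -
    -- 5β/6` in `τ` makes the quadratic terms nearly cancel, so this works up to `β = 1`.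
    have h4 : 1.0987 * (2 / 3 * β * (1 - 5 / 6 * β)) - 2 / 3 * (2 * p - p ^ 2) ≤ -(0.54 * β) := by
      nlinarith
    have h5 := mul_le_mul_of_nonneg_right h4 (mul_nonneg ha0 hc0)
    rw [h2, h3]
    linarith
  have hcover : (selections n k).filter (fun S => SparseCut H τ S) ⊆
      (Finset.Icc 1 (m / 2)).biUnion fun a => (H.powersetCard (m - bb a)).biUnion fun C =>
        ((H \ C).powersetCard a).biUnion fun A => (selections n k).filter fun S =>
          (edgeCount (selectionGraph S) A C : ℝ) < τ * a * C.card / m := by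
    intro S hS
    rw [Finset.mem_filter] at hS
    obtain ⟨hS, a, ha, C, hC, A, hA, hlt⟩ := hS
    simp only [Finset.mem_biUnion]
    exact ⟨a, ha, C, hC, A, hA, Finset.mem_filter.2 ⟨hS, hlt⟩⟩
  have hbound : (((selections n k).filter (fun S => SparseCut H τ S)).card : ℝ) ≤
      ∑ a ∈ Finset.Icc 1 (m / 2), ∑ C ∈ H.powersetCard (m - bb a),
        ∑ A ∈ (H \ C).powersetCard a,
          (selections n k).card * Real.exp (-(0.54 * d * a * (m - bb a : ℕ) / m)) := by
    have h1 : ((selections n k).filter (fun S => SparseCut H τ S)).card ≤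
        ∑ a ∈ Finset.Icc 1 (m / 2), ∑ C ∈ H.powersetCard (m - bb a),
          ∑ A ∈ (H \ C).powersetCard a, ((selections n k).filter fun S =>
            (edgeCount (selectionGraph S) A C : ℝ) < τ * a * C.card / m).card :=
      (Finset.card_le_card hcover).trans (Finset.card_biUnion_le.trans
        (Finset.sum_le_sum fun a _ => Finset.card_biUnion_le.trans
          (Finset.sum_le_sum fun C _ => Finset.card_biUnion_le)))
    refine le_trans (Nat.cast_le (α := ℝ).2 h1) ?_
    push_cast
    exact Finset.sum_le_sum fun a ha => Finset.sum_le_sum fun C hC =>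
      Finset.sum_le_sum fun A hA => hone a ha C hC A hA
  refine hbound.trans (le_trans (le_of_eq ?_) (mul_le_mul_of_nonneg_left
    (union_bound_le hm hδ0 hδ1 hd) (Nat.cast_nonneg _)))
  rw [Finset.mul_sum]
  refine Finset.sum_congr rfl fun a ha => ?_
  have hble : bb a ≤ m := by simp only [hbb]; omega
  have hinner : ∀ C ∈ H.powersetCard (m - bb a), ∑ A ∈ (H \ C).powersetCard a,
      ((selections n k).card * Real.exp (-(0.54 * d * a * (m - bb a : ℕ) / m)) : ℝ) =
      (bb a).choose a *
        ((selections n k).card * Real.exp (-(0.54 * d * a * (m - bb a : ℕ) / m))) := by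
    intro C hC
    rw [Finset.mem_powersetCard] at hC
    rw [Finset.sum_const, Finset.card_powersetCard, Finset.card_sdiff_of_subset hC.1, hC.2,
      nsmul_eq_mul, ← hmdef, Nat.sub_sub_self hble]
  rw [Finset.sum_congr rfl hinner, Finset.sum_const, Finset.card_powersetCard, ← hmdef,
    Nat.choose_symm hble, nsmul_eq_mul]
  ring

open Classical in
/-- A random `k`-out graph is expanding on the honest users with high probability. -/
theorem kOutGraph_not_isExpanding_le {k : ℕ} (hk : k < n) (H : Finset (Fin n)) (hm : 81 ≤ H.card)
    {δ : ℝ} (hδ0 : 0 < δ) (hδ1 : δ ≤ 1)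
    (hd : 4 * Real.log (2 * H.card / δ) ≤ H.card * ((k : ℝ) / n))
    (Q : PMF (Fin n → Finset (Fin n))) :
    (kOutGraph H k hk Q).toOuterMeasure {G | ¬ IsExpanding (G.induce (H : Set (Fin n)))
      (2 / 3 * (H.card * ((k : ℝ) / n)) * (1 - 5 / 6 * ((k : ℝ) / n)))} ≤
      ENNReal.ofReal (2 / 3 * δ) := by
  set τ : ℝ := 2 / 3 * (H.card * ((k : ℝ) / n)) * (1 - 5 / 6 * ((k : ℝ) / n)) with hτ
  rw [kOutGraph, PMF.toOuterMeasure_bind_apply]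
  have hne := selections_nonempty hk
  calc _ ≤ ∑' S, (PMF.uniformOfFinset (selections n k) hne) S *
        ({S | SparseCut H τ S}.indicator 1 S) := by
        refine ENNReal.tsum_le_tsum fun S => ?_
        gcongr
        -- Given the honest selections, the bad event has probability at most 1 if there is a sparse
        -- cut and 0 otherwise, for any malicious selections.
        by_cases hS : SparseCut H τ S
        · rw [Set.indicator_of_mem (by exact hS)]
          rw [PMF.toOuterMeasure_apply, Pi.one_apply]
          exact (ENNReal.tsum_le_tsum fun G => Set.indicator_le_self _ _ _).trans
            (PMF.tsum_coe _).le
        · rw [Set.indicator_of_notMem (by exact hS), PMF.toOuterMeasure_map_apply]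
          refine le_of_eq ?_
          convert measure_empty (μ := Q.toOuterMeasure)
          ext M
          simp only [Set.mem_preimage, Set.mem_ofPred_eq, Set.mem_empty_iff_false, iff_false,
            not_not]
          exact isExpanding_of_not_sparseCut (fun u hu => if_pos hu) hS
    _ = (PMF.uniformOfFinset (selections n k) hne).toOuterMeasure {S | SparseCut H τ S} := by
        rw [PMF.toOuterMeasure_apply]
        refine tsum_congr fun S => ?_
        by_cases hS : SparseCut H τ S
        · rw [Set.indicator_of_mem (by exact hS), Set.indicator_of_mem (by exact hS)]; simp
        · rw [Set.indicator_of_notMem (by exact hS), Set.indicator_of_notMem (by exact hS)]; simp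
    _ ≤ _ := by
        rw [PMF.toOuterMeasure_uniformOfFinset_apply]
        have h1 := card_filter_sparseCut_le hk H hm hδ0 hδ1 hd
        have hpos : (0 : ℝ) < (selections n k).card := by exact_mod_cast Finset.card_pos.2 hne
        refine ENNReal.div_le_of_le_mul ?_
        rw [← ENNReal.ofReal_natCast, ← ENNReal.ofReal_natCast, ← ENNReal.ofReal_mul (by positivity)]
        refine ENNReal.ofReal_le_ofReal ?_
        rw [mul_comm]
        exact h1

/-! ### Averaging the guarantee over the random graph. -/

theorem gopaOnRandomGraph_apply (P : PMF (SimpleGraph (Fin n))) (H : Finset (Fin n))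
    (varEta varDelta : ℝ≥0) (ν : SimpleGraph (Fin n) → ProbabilityMeasure (Noise n))
    (X : Fin n → ℝ) {O : Set (View n H)} (hO : MeasurableSet O) :
    gopaOnRandomGraph P H varEta varDelta ν X O =
      ∑' G, P G * gopa G H varEta varDelta (ν G) X O := by
  rw [gopaOnRandomGraph, Measure.sum_apply _ hO]
  simp only [Measure.smul_apply, smul_eq_mul]

theorem gopaOnRandomGraph_le_one (P : PMF (SimpleGraph (Fin n))) (H : Finset (Fin n))
    (varEta varDelta : ℝ≥0) (ν : SimpleGraph (Fin n) → ProbabilityMeasure (Noise n))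
    (X : Fin n → ℝ) {O : Set (View n H)} (hO : MeasurableSet O) :
    gopaOnRandomGraph P H varEta varDelta ν X O ≤ 1 := by
  rw [gopaOnRandomGraph_apply _ _ _ _ _ _ hO, ← PMF.tsum_coe P]
  refine ENNReal.tsum_le_tsum fun G => ?_
  have := isProbabilityMeasure_gopa G H varEta varDelta (ν G) X
  exact mul_le_of_le_one_right' prob_le_one

/-- If the privacy guarantee holds on all graphs outside of `bad`, then on a random graph the
probability of `bad` is added to the failure probability. -/
theorem gopaOnRandomGraph_le (P : PMF (SimpleGraph (Fin n))) (H : Finset (Fin n))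
    (varEta varDelta : ℝ≥0) (ν : SimpleGraph (Fin n) → ProbabilityMeasure (Noise n))
    {X X' : Fin n → ℝ} {O : Set (View n H)} (hO : MeasurableSet O) (bad : Set (SimpleGraph (Fin n)))
    (e δ₁ δ₂ : ℝ≥0∞) (hbad : P.toOuterMeasure bad ≤ δ₂)
    (hgood : ∀ G ∉ bad, gopa G H varEta varDelta (ν G) X O ≤
      e * gopa G H varEta varDelta (ν G) X' O + δ₁) :
    gopaOnRandomGraph P H varEta varDelta ν X O ≤
      e * gopaOnRandomGraph P H varEta varDelta ν X' O + (δ₁ + δ₂) := by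
  rw [gopaOnRandomGraph_apply _ _ _ _ _ _ hO, gopaOnRandomGraph_apply _ _ _ _ _ _ hO]
  calc _ ≤ ∑' G, (e * (P G * gopa G H varEta varDelta (ν G) X' O) + (P G * δ₁ +
          bad.indicator P G)) := by
        refine ENNReal.tsum_le_tsum fun G => ?_
        by_cases hG : G ∈ bad
        · rw [Set.indicator_of_mem hG]
          have := isProbabilityMeasure_gopa G H varEta varDelta (ν G) X
          exact (mul_le_of_le_one_right' prob_le_one).trans (le_add_self.trans le_add_self)
        · rw [Set.indicator_of_notMem hG, add_zero, mul_left_comm, ← mul_add]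
          gcongr
          exact hgood G hG
    _ = e * ∑' G, P G * gopa G H varEta varDelta (ν G) X' O + (δ₁ + P.toOuterMeasure bad) := by
        rw [ENNReal.tsum_add, ENNReal.tsum_add, ENNReal.tsum_mul_left, ENNReal.tsum_mul_right,
          PMF.tsum_coe, one_mul, PMF.toOuterMeasure_apply]
    _ ≤ _ := by gcongr

/-- The energy bound on expanding graphs in terms of the parameters of the `k`-out graph. -/
theorem expanding_energy_le {m : ℕ} (hm : 81 ≤ m) {d β ρ k : ℝ} (hdm : d = m * β)
    (hβ1 : β ≤ 1) (hd : 20 ≤ d) (hρ0 : 0 ≤ ρ) (hρ1 : ρ ≤ 1) (hdk : d = ρ * k) :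
    0 < 2 / 3 * d * (1 - 5 / 6 * β) ∧
    0 < 1 / ((⌊(k - 1) * ρ / 3⌋ : ℝ) - 1) + (12 + 6 * Real.log m) / m ∧
    2 / (2 / 3 * d * (1 - 5 / 6 * β)) + 6 * Nat.log 2 m / (2 / 3 * d * (1 - 5 / 6 * β) * m) ≤
      1 / ((⌊(k - 1) * ρ / 3⌋ : ℝ) - 1) + (12 + 6 * Real.log m) / m := by
  have hmR : (81 : ℝ) ≤ m := by exact_mod_cast hm
  have hm0 : (0 : ℝ) < m := by linarith
  have hd0 : 0 < d := by linarith
  have hβ0 : 0 < β := by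
    by_contra hcon
    push Not at hcon
    nlinarith
  set τ := 2 / 3 * d * (1 - 5 / 6 * β) with hτ
  have hτ9 : d / 9 ≤ τ := by rw [hτ]; nlinarith
  have hτ0 : 0 < τ := by linarith
  have hL : 4.3 ≤ Real.log m := by
    have h1 : Real.log (3 ^ 4) ≤ Real.log m := Real.log_le_log (by norm_num) (by linarith)
    rw [Real.log_pow] at h1
    have := log_three_gt
    push_cast at h1
    linarith
  have hfloor : (⌊(k - 1) * ρ / 3⌋ : ℝ) ≤ (k - 1) * ρ / 3 := Int.floor_le _
  have hfloor' : (k - 1) * ρ / 3 < (⌊(k - 1) * ρ / 3⌋ : ℝ) + 1 := Int.lt_floor_add_one _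
  have hK : (k - 1) * ρ / 3 = (d - ρ) / 3 := by rw [hdk]; ring
  rw [hK] at hfloor hfloor' ⊢
  set K := (⌊(d - ρ) / 3⌋ : ℝ)
  have hK0 : 0 < K - 1 := by linarith
  have hKd : 3 / d ≤ 1 / (K - 1) := by
    rw [div_le_div_iff₀ hd0 hK0]; linarith
  refine ⟨hτ0, by positivity, ?_⟩
  -- Here `2/τ = (3/d) / (1 - 5β/6)`, where `1 / (1 - 5β/6) ≤ 1 + 5β` for `β ≤ 1`, and `β/d = 1/m`.
  have h1 : 2 / τ ≤ 3 / d + 15 / m := by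
    have e1 : (m : ℝ) = d / β := by rw [hdm]; field_simp
    have e2 : 3 / d + 15 / m = (3 + 15 * β) / d := by rw [e1]; field_simp
    rw [e2, div_le_div_iff₀ hτ0 hd0, hτ]
    nlinarith [mul_nonneg hβ0.le (sub_nonneg.2 hβ1), mul_nonneg (mul_nonneg hβ0.le (sub_nonneg.2 hβ1)) hd0.le]
  have hJ : (Nat.log 2 m : ℝ) * 0.69 ≤ Real.log m := by
    have h2 : (2 : ℝ) ^ Nat.log 2 m ≤ m := by
      exact_mod_cast Nat.pow_log_le_self 2 (by omega)
    have h3 := Real.log_le_log (by positivity) h2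
    rw [Real.log_pow] at h3
    have := Real.log_two_gt_d9
    have h4 : (0 : ℝ) ≤ Nat.log 2 m := Nat.cast_nonneg _
    nlinarith
  -- As `τ ≥ d/9 ≥ 20/9`, the logarithmic term leaves room for the `-3` that reduces `15` to the
  -- stated `12`.
  have h2 : 6 * (Nat.log 2 m : ℝ) / (τ * m) ≤ (6 * Real.log m - 3) / m := by
    rw [div_le_div_iff₀ (by positivity) hm0]
    have h3 : 6 * (Nat.log 2 m : ℝ) ≤ (6 * Real.log m - 3) * τ := by nlinarith
    nlinarith
  have h3 : (12 + 6 * Real.log m) / m = 15 / m + (6 * Real.log m - 3) / m := by ring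
  rw [h3]
  linarith

end Gopa

/-! ### The three regimes, with energy bounds `1/m`, the bracket in the variance, and `m/3`. -/

theorem corollary1 (n : ℕ) (H : Finset (Fin n)) (ρ : ℝ) (hρ : ρ = (H.card : ℝ) / n)
    (ε δ' c κ : ℝ) (hε0 : 0 < ε) (hε1 : ε < 1) (hδ'0 : 0 < δ') (hδ'1 : δ' < 1)
    (hc : 2 * Real.log (1.25 / δ') < c ^ 2) (hκ : 0 < κ)
    (varEta : ℝ≥0) (hEta : (varEta : ℝ) = c ^ 2 / (H.card * ε ^ 2)) :
    -- complete graph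
    (∀ G : SimpleGraph (Fin n), G.induce (H : Set (Fin n)) = ⊤ →
      ∀ varDelta : ℝ≥0, (varDelta : ℝ) = κ * varEta →
      ∀ δ : ℝ, 1.25 * (δ' / 1.25) ^ (κ / (κ + 1)) ≤ δ →
      ∀ ν : ProbabilityMeasure (Gopa.Noise n),
        Gopa.IsDP H ε δ (Gopa.gopa G H varEta varDelta ν)) ∧
    -- random `k`-out graph
    (∀ (k : ℕ) (hk : k < n) (varDelta : ℝ≥0),
      (varDelta : ℝ) = κ * varEta * H.card *
        (1 / ((⌊((k : ℝ) - 1) * ρ / 3⌋ : ℝ) - 1) + (12 + 6 * Real.log H.card) / H.card) →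
      ∀ δ : ℝ, 3.75 * (δ' / 1.25) ^ (κ / (κ + 1)) ≤ δ →
      81 ≤ ρ * n →
      4 * Real.log (2 * ρ * n / (3 * (δ / 3))) ≤ ρ * k →
      6 * Real.log (ρ * n / 3) ≤ ρ * k →
      3 / 2 + 9 / 4 * Real.log (2 * Real.exp 1 / (δ / 3)) ≤ ρ * k →
      ∀ (Q : PMF (Fin n → Finset (Fin n)))
        (ν : SimpleGraph (Fin n) → ProbabilityMeasure (Gopa.Noise n)),
        Gopa.IsDP H ε δ
          (Gopa.gopaOnRandomGraph (Gopa.kOutGraph H k hk Q) H varEta varDelta ν)) ∧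
    -- arbitrary connected honest subgraph
    (∀ G : SimpleGraph (Fin n), (G.induce (H : Set (Fin n))).Connected →
      ∀ varDelta : ℝ≥0, (varDelta : ℝ) = κ * varEta * (H.card : ℝ) ^ 2 / 3 →
      ∀ δ : ℝ, 1.25 * (δ' / 1.25) ^ (κ / (κ + 1)) ≤ δ →
      ∀ ν : ProbabilityMeasure (Gopa.Noise n),
        Gopa.IsDP H ε δ (Gopa.gopa G H varEta varDelta ν)) := by
  classical
  have hcard : Fintype.card (H : Set (Fin n)) = H.card := Fintype.card_coe H
  have hpos : ∀ v ∈ H, (0 : ℝ) < H.card := fun v hv => by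
    exact_mod_cast Finset.card_pos.2 ⟨v, hv⟩
  refine ⟨?_, ?_, ?_⟩
  · intro G hG varDelta hDelta δ hδ ν v hv X X' hX hX' hXX' O hO
    have hm := hpos v hv
    have hne : Nonempty (H : Set (Fin n)) := ⟨⟨v, hv⟩⟩
    obtain ⟨f, hf, hE⟩ := Gopa.energy_le_of_complete _ hG (⟨v, hv⟩ : (H : Set (Fin n)))
    rw [hcard] at hE
    exact Gopa.gopa_le_of_potential G H ⟨v, hv⟩ (B := 1 / H.card) (one_div_pos.2 hm) hf hE hε0 hε1
      hδ'0 hδ'1 hc hκ hEta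
      (by rw [hDelta, mul_assoc _ (H.card : ℝ), mul_one_div_cancel hm.ne', mul_one])
      hδ ν hX hX' hXX' hO
  · intro k hk varDelta hDelta δ hδ h81 hd _ _ Q ν v hv X X' hX hX' hXX' O hO
    have hm := hpos v hv
    have hne : Nonempty (H : Set (Fin n)) := ⟨⟨v, hv⟩⟩
    rcases le_or_gt 1 δ with hδ1 | hδ1
    · exact (Gopa.gopaOnRandomGraph_le_one _ _ _ _ _ _ hO).trans
        ((ENNReal.one_le_ofReal.2 hδ1).trans le_add_self)
    have hn0 : (0 : ℝ) < n := by exact_mod_cast (Nat.zero_lt_of_lt hk)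
    have hρn : ρ * n = H.card := by rw [hρ]; field_simp
    have hδ0 : 0 < δ :=
      lt_of_lt_of_le (mul_pos (by norm_num) (Real.rpow_pos_of_pos (by positivity) _)) hδ
    have hm81 : 81 ≤ H.card := by rw [hρn] at h81; exact_mod_cast h81
    have hρk : ρ * k = H.card * ((k : ℝ) / n) := by rw [hρ]; ring
    have hd' : 4 * Real.log (2 * H.card / δ) ≤ H.card * ((k : ℝ) / n) := by
      rw [← hρk, ← hρn]
      convert hd using 4
      · ring
      · ring
    have hHn : (H.card : ℝ) ≤ n := by
      exact_mod_cast (Finset.card_le_univ H).trans (Fintype.card_fin n).le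
    have hd20 : 20 ≤ ρ * k := by
      rw [hρk]
      refine le_trans ?_ hd'
      have h1 := Gopa.log_two_mul_gt (m := H.card) (by exact_mod_cast hm81)
      have h2 : Real.log (2 * H.card) ≤ Real.log (2 * H.card / δ) := by
        refine Real.log_le_log (mul_pos two_pos hm) ?_
        rw [le_div_iff₀ hδ0]
        nlinarith
      linarith
    obtain ⟨hτ, hB, hle⟩ := Gopa.expanding_energy_le hm81 (d := ρ * k) (β := (k : ℝ) / n) (ρ := ρ)
      (k := k) hρk (div_le_one_of_le₀ (by exact_mod_cast hk.le) hn0.le) hd20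
      (by rw [hρ]; exact div_nonneg hm.le hn0.le) (by rw [hρ]; exact div_le_one_of_le₀ hHn hn0.le) rfl
    -- One third goes to the Gaussian mechanism, whence `3.75 = 3 * 1.25`; two thirds go to the
    -- failure of expansion.
    have hsplit : ENNReal.ofReal δ = ENNReal.ofReal (δ / 3) + ENNReal.ofReal (2 / 3 * δ) := by
      rw [← ENNReal.ofReal_add (by linarith) (by linarith)]
      congr 1
      ring
    rw [hsplit]
    refine Gopa.gopaOnRandomGraph_le _ H varEta varDelta ν hO _ _ _ _
      (Gopa.kOutGraph_not_isExpanding_le hk H hm81 hδ0 hδ1.le hd' Q) ?_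
    intro G hG
    rw [Set.mem_ofPred_eq, not_not, ← hρk] at hG
    obtain ⟨f, hf, hE⟩ := Gopa.energy_le_of_isExpanding _ hτ hG (⟨v, hv⟩ : (H : Set (Fin n)))
    rw [hcard] at hE
    refine Gopa.gopa_le_of_potential G H ⟨v, hv⟩ hB hf (hE.trans hle) hε0 hε1
      hδ'0 hδ'1 hc hκ hEta hDelta ?_ (ν G) hX hX' hXX' hO
    have e : (3.75 : ℝ) * (δ' / 1.25) ^ (κ / (κ + 1)) =
        3 * (1.25 * (δ' / 1.25) ^ (κ / (κ + 1))) := by ring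
    rw [e] at hδ
    linarith
  · intro G hG varDelta hDelta δ hδ ν v hv X X' hX hX' hXX' O hO
    have hm := hpos v hv
    obtain ⟨f, hf, hE⟩ := Gopa.energy_le_of_connected _ hG (⟨v, hv⟩ : (H : Set (Fin n)))
    rw [hcard] at hE
    exact Gopa.gopa_le_of_potential G H ⟨v, hv⟩ (B := H.card / 3) (by linarith) hf hE hε0 hε1
      hδ'0 hδ'1 hc hκ hEta (by rw [hDelta]; ring) hδ ν hX hX' hXX' hO
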